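/- All graphs are finite and undirected, and may have loops and multiple edges. For a graph $G=(V,E)$, $q\in\mathbb C$ and edge weights $\mathbf v=(v_e)_{e\in E}$ put $$Z_G(q,\mathbf v)=\sum_{A\subseteq E}q^{k(A)}\prod_{e\in A}v_e ,$$ where $k(A)$ is the number of connected components of $(V,A)$; the chromatic polynomial is $P_G(q)=Z_G(q,\{-1\})$. For distinct vertices $x,y$ let $\lambda_G(x,y)$ be the minimum number of edges separating $x$ from $y$ (equivalently, the maximum number of edge-disjoint $xy$-paths), and let the maxmaxflow of $G$ be $\max_{x\ne y}\lambda_G(x,y)$ (and $0$ if $G$ has at most one vertex). A 2-terminal graph $(G,s,t)$ is a graph with two distinct vertices $s,t$. The parallel composition of $(G_1,s_1,t_1)$ and $(G_2,s_2,t_2)$ is obtained from the disjoint union by identifying $s_1$ with $s_2$ and $t_1$ with $t_2$ (terminals $s_1,t_1$); the series composition by identifying $t_1$ with $s_2$ (terminals $s_1,t_2$). A 2-terminal graph is 2-terminal series-parallel if it can be obtained from single edges (with their ends as terminals) by these two operations; it is prime if it is not the series or parallel composition of two strictly smaller 2-terminal graphs. A decomposition tree of $(G,s,t)$ is a rooted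 binary tree of connected 2-terminal graphs (the constituents) with root $(G,s,t)$, in which every non-leaf node is the series or the parallel composition of its two children; it is maximal if all its leaves are prime. A constituent is proper if it is not equal to $(G,s,t)$. The between-terminals flow of a node $(H,a,b)$ is $\lambda_H(a,b)$. For $q\neq 0$, its effective weight is $$v_{\rm eff}(H,a,b)=\frac{B}{A},\qquad A=q^{-2}\!\!\sum_{E':\,a\not\leftrightarrow b}\!\! q^{k(E')}\prod_{e\in E'}v_e,\qquad B=q^{-1}\!\!\sum_{E':\,a\leftrightarrow b}\!\! q^{k(E')}\prod_{e\in E'}v_e ,$$ where the first sum is over the $E'\subseteq E(H)$ that do not connect $a$ to $b$ and the second over those that do; it is undefined if $A=0$. A loopless graph is series-parallel if it can be obtained from a forest by finitely many (possibly no) replacements of an edge by two edges in series or by two edges in parallel. For $a,b\in\mathbb C$ let $a\parallel b=(1+a)(1+b)-1$, and let $a\bowtie_q b=\frac{ab}{q+a+b}$, which is undefined if $q+a+b=0$. For $X,Y\subseteq\mathbb C$ let $X\parallel Y=\{x\parallel y: x\in X,y\in Y\}$, and likewise for $\bowtie_q$; the inclusion (1) below includes the assertion that all the operations in it are defined. **Theorem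 4.1.** Let $q\ne 0$ be a fixed complex number and let $\Lambda\ge 2$ be a fixed integer. Let $S_1\subseteq S_2\subseteq\dots\subseteq S_{\Lambda-1}$ be subsets of $\mathbb C$ such that 1. $S_k\bowtie_q S_\ell\subseteq S_{\min(k,\ell)}$ for all $k,\ell\in\{1,\dots,\Lambda-1\}$; 2. $S_k\parallel S_\ell\subseteq S_{k+\ell}$ for all $k,\ell\ge 1$ with $k+\ell\le\Lambda-1$. Consider any 2-terminal series-parallel graph $(G,s,t)$ and any maximal decomposition tree for $(G,s,t)$ in which all the proper constituents have between-terminals flow at most $\Lambda-1$, and equip $G$ with edge weights $v_e\in S_1$. Then for every node $(H,a,b)$ of the decomposition tree (including the root) with $\lambda_H(a,b)\le\Lambda-1$, the effective weight $v_{\rm eff}(H,a,b)$ is defined and lies in $S_{\lambda_H(a,b)}$. Assume further, in addition to (1) and (2), that 3. $-q\notin S_{\Lambda-1}$; 4. $-q\notin S_k\parallel S_\ell$ for all $k,\ell\ge1$ with $k+\ell=\Lambda$. Then for any loopless series-parallel graph $G$ with maxmaxflow at most $\Lambda$, we have $Z_G(q,\mathbf v)\ne 0$ whenever $v_e\in S_1$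 for all edges $e$. In particular, if $-1\in S_1$, then $q$ is not a root of the chromatic polynomial $P_G$. -/

import Mathlib

open scoped Graph

namespace Potts

/-! ### Parallel and series connection of edge weights -/

/-- Parallel connection of two weights. -/
def par (a b : ℂ) : ℂ := (1 + a) * (1 + b) - 1

open Classical in
/-- Series connection of two weights at the parameter `q`; the value `none` stands for
"undefined", and it is taken exactly when the denominator vanishes. -/
noncomputable def ser (q a b : ℂ) : Option ℂ :=
  if q + a + b = 0 then none else some (a * b / (q + a + b))

/-! ### Connectivity, multivariate Tutte polynomial, flows -/

section graphs

variable {α β : Type*}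

/-- `x` and `y` are joined by a (possibly empty) walk in `G` that uses only edges in `A`. -/
def Conn (G : Graph α β) (A : Set β) (x y : α) : Prop :=
  Relation.ReflTransGen (fun a b => ∃ e ∈ A, G.IsLink e a b) x y

/-- A graph is connected if it has a vertex and any two vertices are joined by a walk. -/
def IsConnected (G : Graph α β) : Prop :=
  V(G).Nonempty ∧ ∀ x ∈ V(G), ∀ y ∈ V(G), Conn G E(G) x y

/-- The number of connected components of the spanning subgraph `(V(G), A)`. -/
noncomputable def numComponents (G : Graph α β) (A : Set β) : ℕ :=
  {C : Set α | ∃ x ∈ V(G), C = {y | y ∈ V(G) ∧ Conn G A x y}}.ncard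

/-- The multivariate Tutte polynomial `∑_{A ⊆ E(G)} q ^ k(A) ∏_{e ∈ A} v e` of a finite graph,
at elements `q`, `v e` of any commutative ring. -/
noncomputable def tutte {R : Type*} [CommRing R] (G : Graph α β) (q : R) (v : β → R) : R :=
  ∑ᶠ A ∈ {A : Finset β | (A : Set β) ⊆ E(G)}, q ^ numComponents G A * ∏ e ∈ A, v e

/-- The chromatic polynomial: all weights are `-1`. -/
noncomputable def chromaticPolynomial (G : Graph α β) : Polynomial ℂ :=
  tutte G Polynomial.X (fun _ => -1)

/-- The maximum flow between two distinct vertices of a finite graph: the minimum number of edges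
whose removal separates them. -/
noncomputable def flow (G : Graph α β) (x y : α) : ℕ :=
  sInf {n | ∃ C : Finset β, (C : Set β) ⊆ E(G) ∧ C.card = n ∧ ¬ Conn G (E(G) \ C) x y}

/-- The maxmaxflow of a finite graph: the largest flow between two distinct vertices
(and `0` if there is at most one vertex). -/
noncomputable def maxmaxflow (G : Graph α β) : ℕ :=
  sSup {n | ∃ x ∈ V(G), ∃ y ∈ V(G), x ≠ y ∧ n = flow G x y}

/-! ### Series-parallel graphs -/

/-- A forest: no loops, no multiple edges, no cycles. -/
def IsForest (G : Graph α β) : Prop :=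
  G.Simple ∧ G.toSimpleGraph.IsAcyclic

/-- `G'` arises from `G` by replacing one edge `e = xy` by two edges `f₁ = xw`, `f₂ = wy` in
series, where `w` is a new vertex. (The name `e` may be reused for one of the new edges.) -/
def IsSeriesExtension (G G' : Graph α β) : Prop :=
  ∃ (e f₁ f₂ : β) (x y w : α), G.IsLink e x y ∧ w ∉ V(G) ∧
    f₁ ≠ f₂ ∧ f₁ ∉ E(G) \ {e} ∧ f₂ ∉ E(G) \ {e} ∧
    V(G') = insert w V(G) ∧
    ∀ f a b, G'.IsLink f a b ↔
      (f ≠ e ∧ G.IsLink f a b) ∨ (f = f₁ ∧ s(a, b) = s(x, w)) ∨ (f = f₂ ∧ s(a, b) = s(w, y))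

/-- `G'` arises from `G` by replacing one edge `e = xy` by two parallel edges `f₁`, `f₂`
between `x` and `y`. (The name `e` may be reused for one of the new edges.) -/
def IsParallelExtension (G G' : Graph α β) : Prop :=
  ∃ (e f₁ f₂ : β) (x y : α), G.IsLink e x y ∧
    f₁ ≠ f₂ ∧ f₁ ∉ E(G) \ {e} ∧ f₂ ∉ E(G) \ {e} ∧
    V(G') = V(G) ∧
    ∀ f a b, G'.IsLink f a b ↔
      (f ≠ e ∧ G.IsLink f a b) ∨ (f = f₁ ∧ s(a, b) = s(x, y)) ∨ (f = f₂ ∧ s(a, b) = s(x, y))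

/-- The graphs obtained from a forest by finitely many series and parallel extensions. -/
inductive FromForest : Graph α β → Prop
  | forest {G : Graph α β} : IsForest G → FromForest G
  | series {G G' : Graph α β} : FromForest G → IsSeriesExtension G G' → FromForest G'
  | parallel {G G' : Graph α β} : FromForest G → IsParallelExtension G G' → FromForest G'

/-- A graph is series-parallel if its underlying loopless graph can be obtained from a forest by
series and parallel extensions. -/
def IsSeriesParallel (G : Graph α β) : Prop :=
  FromForest (G.deleteEdges {e | ∃ x, G.IsLoopAt e x})

end graphs

/-! ### 2-terminal graphs -/

/-- A graph with two distinct distinguished vertices. -/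
@[ext] structure TwoTerminal (α β : Type*) where
  graph : Graph α β
  s : α
  t : α
  s_mem : s ∈ V(graph)
  t_mem : t ∈ V(graph)
  s_ne_t : s ≠ t

namespace TwoTerminal

variable {α β : Type*}

/-- `K` is the parallel composition of its subgraphs `K₁` and `K₂`: these share precisely the two
terminals. -/
structure IsParallel (K K₁ K₂ : TwoTerminal α β) : Prop where
  le_left : K₁.graph ≤ K.graph
  le_right : K₂.graph ≤ K.graph
  union_vertex : V(K₁.graph) ∪ V(K₂.graph) = V(K.graph)
  union_edge : E(K₁.graph) ∪ E(K₂.graph) = E(K.graph)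
  disjoint_edge : Disjoint E(K₁.graph) E(K₂.graph)
  inter_vertex : V(K₁.graph) ∩ V(K₂.graph) = {K.s, K.t}
  s_left : K₁.s = K.s
  s_right : K₂.s = K.s
  t_left : K₁.t = K.t
  t_right : K₂.t = K.t

/-- `K` is the series composition of its subgraphs `K₁` and `K₂` (in this order): these share
precisely the vertex that is the second terminal of `K₁` and the first terminal of `K₂`. -/
structure IsSeries (K K₁ K₂ : TwoTerminal α β) : Prop where
  le_left : K₁.graph ≤ K.graph
  le_right : K₂.graph ≤ K.graph
  union_vertex : V(K₁.graph) ∪ V(K₂.graph) = V(K.graph)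
  union_edge : E(K₁.graph) ∪ E(K₂.graph) = E(K.graph)
  disjoint_edge : Disjoint E(K₁.graph) E(K₂.graph)
  inter_vertex : V(K₁.graph) ∩ V(K₂.graph) = {K₁.t}
  s_left : K₁.s = K.s
  middle : K₁.t = K₂.s
  t_right : K₂.t = K.t

/-- `K` is a single edge joining its two terminals. -/
def IsEdge (K : TwoTerminal α β) : Prop :=
  V(K.graph) = {K.s, K.t} ∧ ∃ e, E(K.graph) = {e} ∧ K.graph.IsLink e K.s K.t

/-- 2-terminal series-parallel graphs. -/
inductive IsSP : TwoTerminal α β → Prop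
  | edge {K : TwoTerminal α β} : K.IsEdge → IsSP K
  | series {K K₁ K₂ : TwoTerminal α β} : IsSP K₁ → IsSP K₂ → K.IsSeries K₁ K₂ → IsSP K
  | parallel {K K₁ K₂ : TwoTerminal α β} : IsSP K₁ → IsSP K₂ → K.IsParallel K₁ K₂ → IsSP K

/-- `K` is not the parallel or series composition of two strictly smaller 2-terminal graphs. -/
def IsPrime (K : TwoTerminal α β) : Prop :=
  ∀ K₁ K₂ : TwoTerminal α β, K₁.graph < K.graph → K₂.graph < K.graph →
    ¬ K.IsParallel K₁ K₂ ∧ ¬ K.IsSeries K₁ K₂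

/-- The between-terminals flow. -/
noncomputable def terminalFlow (K : TwoTerminal α β) : ℕ := flow K.graph K.s K.t

/-- The part of the multivariate Tutte polynomial in which the terminals are not connected. -/
noncomputable def tutteDisc (K : TwoTerminal α β) (q : ℂ) (v : β → ℂ) : ℂ :=
  ∑ᶠ A ∈ {A : Finset β | (A : Set β) ⊆ E(K.graph) ∧ ¬ Conn K.graph A K.s K.t},
    q ^ numComponents K.graph A * ∏ e ∈ A, v e

/-- The part of the multivariate Tutte polynomial in which the terminals are connected. -/
noncomputable def tutteConn (K : TwoTerminal α β) (q : ℂ) (v : β → ℂ) : ℂ :=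
  ∑ᶠ A ∈ {A : Finset β | (A : Set β) ⊆ E(K.graph) ∧ Conn K.graph A K.s K.t},
    q ^ numComponents K.graph A * ∏ e ∈ A, v e

open Classical in
/-- The effective weight `B / A` (for `q ≠ 0`), where `A = q⁻² Z^(s≁t)` and `B = q⁻¹ Z^(s∼t)`;
it is `none`, i.e. undefined, if `A` vanishes. -/
noncomputable def effWeight (K : TwoTerminal α β) (q : ℂ) (v : β → ℂ) : Option ℂ :=
  if K.tutteDisc q v = 0 then none
  else some ((K.tutteConn q v / q) / (K.tutteDisc q v / q ^ 2))

end TwoTerminal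

/-- Decomposition trees of a 2-terminal graph: rooted binary trees whose nodes are connected
2-terminal graphs. -/
inductive DecompTree {α β : Type*} : TwoTerminal α β → Type _
  | leaf {K : TwoTerminal α β} (hK : IsConnected K.graph) : DecompTree K
  | snode {K K₁ K₂ : TwoTerminal α β} (hK : IsConnected K.graph) (h : K.IsSeries K₁ K₂)
      (T₁ : DecompTree K₁) (T₂ : DecompTree K₂) : DecompTree K
  | pnode {K K₁ K₂ : TwoTerminal α β} (hK : IsConnected K.graph) (h : K.IsParallel K₁ K₂)
      (T₁ : DecompTree K₁) (T₂ : DecompTree K₂) : DecompTree K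

namespace DecompTree

variable {α β : Type*}

/-- The 2-terminal graphs at the nodes of the tree (the constituents). -/
def nodes : {K : TwoTerminal α β} → DecompTree K → Set (TwoTerminal α β)
  | K, .leaf _ => {K}
  | K, .snode _ _ T₁ T₂ => insert K (T₁.nodes ∪ T₂.nodes)
  | K, .pnode _ _ T₁ T₂ => insert K (T₁.nodes ∪ T₂.nodes)

/-- The 2-terminal graphs at the leaves of the tree. -/
def leaves : {K : TwoTerminal α β} → DecompTree K → Set (TwoTerminal α β)
  | K, .leaf _ => {K}
  | _, .snode _ _ T₁ T₂ => T₁.leaves ∪ T₂.leaves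
  | _, .pnode _ _ T₁ T₂ => T₁.leaves ∪ T₂.leaves

/-- A decomposition tree is maximal if every leaf is prime. -/
def IsMaximal {K : TwoTerminal α β} (T : DecompTree K) : Prop :=
  ∀ L ∈ T.leaves, L.IsPrime

end DecompTree

end Potts

/-! Both halves rest on replacing a 2-terminal piece by one edge.

For the first half, split a 2-terminal graph in series or in parallel. The number of components of a
union of edge sets is determined by the numbers for the two parts and, in the parallel case, by
whether both parts connect the terminals. So the partial sums with connected and with disconnected
terminals multiply out (`IsSeries.tutte_mul`, `IsParallel.tutte_mul`), and the effective weight of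
the whole is `ser` or `par` of those of the parts. Correspondingly, flows combine by minimum and by
sum. The closure hypotheses then carry membership in `S λ` from the leaves up. The delicate point is
that the given tree need not be the one by which the graph was built: one must show that connected
parts of any series or parallel split of a series-parallel graph are again series-parallel
(`SPEdges.of_series`, `SPEdges.of_parallel`). It follows that all nodes are series-parallel and that
prime leaves are single edges.

The second half does not pass through decomposition trees. It undoes the extensions that produced
`G` from a forest, letting each edge carry a weight and a capacity, the latter being the flow
through the piece for which the edge stands. Merging two edges changes `Z` by a nonzero factor, and
all pairs of vertices keep cuts of capacity at most `Λ` (`CutsLE`). An edge of capacity below `Λ`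
has its weight in the corresponding `S k`; an edge of capacity `Λ` has it in some `S i ∥ S j` with
`i + j = Λ`. Parallel edges of positive capacity sum to at most `Λ`, so both are below `Λ`. A series
pair with an edge of capacity `Λ` is not covered by the closure hypothesis, but there the merged
edge is a bridge and `Z` factorises anyway (`SeriesExt.not_conn`). In the final forest every edge
contributes a factor `1 + v e / q`, which is nonzero because `-q` is excluded. -/

namespace Potts
open Relation

/-! ### Classes of a symmetric relation when a link or an isolated point is added. -/

section relations

variable {α : Type*}

/-- The relation `r` together with a link between `x` and `y`. -/
def addLink (r : α → α → Prop) (x y : α) : α → α → Prop :=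
  fun a b => r a b ∨ (a = x ∧ b = y) ∨ (a = y ∧ b = x)

/-- The number of classes into which `V` is divided by the walks along `r`. -/
noncomputable def comps (V : Set α) (r : α → α → Prop) : ℕ :=
  {C : Set α | ∃ x ∈ V, C = {y | y ∈ V ∧ ReflTransGen r x y}}.ncard

theorem reflTransGen_symm {r : α → α → Prop} (hr : ∀ a b, r a b → r b a) {x y : α}
    (h : ReflTransGen r x y) : ReflTransGen r y x := by
  induction h with
  | refl => exact .refl
  | tail _ h ih => exact .head (hr _ _ h) ih

theorem addLink_symm {r : α → α → Prop} (hr : ∀ a b, r a b → r b a) (x y a b : α)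
    (h : addLink r x y a b) : addLink r x y b a := by
  rcases h with h | h | h
  · exact .inl (hr _ _ h)
  · exact .inr (.inr ⟨h.2, h.1⟩)
  · exact .inr (.inl ⟨h.2, h.1⟩)

theorem reflTransGen_addLink_iff (r : α → α → Prop) (x y a b : α) :
    ReflTransGen (addLink r x y) a b ↔ ReflTransGen r a b ∨
      (ReflTransGen r a x ∧ ReflTransGen r y b) ∨ (ReflTransGen r a y ∧ ReflTransGen r x b) := by
  have hm : ∀ {c d}, ReflTransGen r c d → ReflTransGen (addLink r x y) c d :=
    fun h => ReflTransGen.mono (fun _ _ => Or.inl) _ _ h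
  constructor
  · intro h
    induction h with
    | refl => exact .inl .refl
    | tail _ h ih =>
      rcases h with h | ⟨rfl, rfl⟩ | ⟨rfl, rfl⟩
      · rcases ih with ih | ih | ih
        · exact .inl (ih.tail h)
        · exact .inr (.inl ⟨ih.1, ih.2.tail h⟩)
        · exact .inr (.inr ⟨ih.1, ih.2.tail h⟩)
      · rcases ih with ih | ih | ih
        · exact .inr (.inl ⟨ih, .refl⟩)
        · exact .inr (.inl ⟨ih.1, .refl⟩)
        · exact .inl ih.1
      · rcases ih with ih | ih | ih
        · exact .inr (.inr ⟨ih, .refl⟩)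
        · exact .inl ih.1
        · exact .inr (.inr ⟨ih.1, .refl⟩)
  · rintro (h | h | h)
    · exact hm h
    · exact ((hm h.1).tail (.inr (.inl ⟨rfl, rfl⟩))).trans (hm h.2)
    · exact ((hm h.1).tail (.inr (.inr ⟨rfl, rfl⟩))).trans (hm h.2)

theorem comps_congr {V : Set α} {r r' : α → α → Prop}
    (h : ∀ x ∈ V, ∀ y ∈ V, ReflTransGen r x y ↔ ReflTransGen r' x y) :
    comps V r = comps V r' := by
  unfold comps
  congr 1
  ext C
  have : ∀ x ∈ V, {y | y ∈ V ∧ ReflTransGen r x y} = {y | y ∈ V ∧ ReflTransGen r' x y} := by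
    intro x hx
    ext y
    exact and_congr_right fun hy => h x hx y hy
  exact exists_congr fun x => and_congr_right fun hx => by rw [this x hx]

theorem comps_addLink_of_conn {V : Set α} {r : α → α → Prop} (hr : ∀ a b, r a b → r b a)
    {x y : α} (h : ReflTransGen r x y) : comps V (addLink r x y) = comps V r := by
  refine comps_congr fun a _ b _ => ?_
  rw [reflTransGen_addLink_iff]
  refine ⟨?_, .inl⟩
  rintro (h' | h' | h')
  · exact h'
  · exact (h'.1.trans h).trans h'.2
  · exact (h'.1.trans (reflTransGen_symm hr h)).trans h'.2

/-- The classes `X` of `x` and `Y` of `y` fuse into `X ∪ Y`, while the family `R` of all other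
classes is untouched. -/
theorem comps_addLink_of_not_conn {V : Set α} (hV : V.Finite) {r : α → α → Prop}
    (hr : ∀ a b, r a b → r b a) {x y : α} (hx : x ∈ V) (hy : y ∈ V)
    (h : ¬ ReflTransGen r x y) : comps V (addLink r x y) + 1 = comps V r := by
  have hs : ∀ {a b}, ReflTransGen r a b → ReflTransGen r b a := reflTransGen_symm hr
  set R : Set (Set α) := {C | ∃ z ∈ V, ¬ ReflTransGen r z x ∧ ¬ ReflTransGen r z y ∧
    C = {y | y ∈ V ∧ ReflTransGen r z y}} with hR
  have hfin : R.Finite := hV.finite_subsets.subset <| by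
    rintro C ⟨z, -, -, -, rfl⟩ a ha
    exact ha.1
  set X : Set α := {z | z ∈ V ∧ ReflTransGen r x z} with hX
  set Y : Set α := {z | z ∈ V ∧ ReflTransGen r y z} with hY
  have e1 : {C : Set α | ∃ a ∈ V, C = {z | z ∈ V ∧ ReflTransGen r a z}} =
      insert X (insert Y R) := by
    ext C
    constructor
    · rintro ⟨a, ha, rfl⟩
      by_cases h1 : ReflTransGen r a x
      · left
        ext z
        exact and_congr_right fun _ => ⟨fun h => (hs h1).trans h, fun h => h1.trans h⟩
      by_cases h2 : ReflTransGen r a y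
      · right; left
        ext z
        exact and_congr_right fun _ => ⟨fun h => (hs h2).trans h, fun h => h2.trans h⟩
      exact .inr (.inr ⟨a, ha, h1, h2, rfl⟩)
    · rintro (rfl | rfl | ⟨a, ha, -, -, rfl⟩)
      exacts [⟨x, hx, rfl⟩, ⟨y, hy, rfl⟩, ⟨a, ha, rfl⟩]
  have e2 : {C : Set α | ∃ a ∈ V, C = {z | z ∈ V ∧ ReflTransGen (addLink r x y) a z}} =
      insert (X ∪ Y) R := by
    have key : ∀ a, ReflTransGen r a x ∨ ReflTransGen r a y →
        {z | z ∈ V ∧ ReflTransGen (addLink r x y) a z} = X ∪ Y := by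
      intro a ha
      ext z
      simp only [hX, hY, Set.mem_ofPred_eq, Set.mem_union, ← and_or_left,
        reflTransGen_addLink_iff]
      refine and_congr_right fun _ => ?_
      rcases ha with ha | ha
      · constructor
        · rintro (h' | h' | h')
          exacts [.inl ((hs ha).trans h'), .inr h'.2, .inl h'.2]
        · rintro (h' | h')
          exacts [.inl (ha.trans h'), .inr (.inl ⟨ha, h'⟩)]
      · constructor
        · rintro (h' | h' | h')
          exacts [.inr ((hs ha).trans h'), .inr h'.2, .inl h'.2]
        · rintro (h' | h')
          exacts [.inr (.inr ⟨ha, h'⟩), .inl (ha.trans h')]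
    have key2 : ∀ a, ¬ ReflTransGen r a x → ¬ ReflTransGen r a y →
        {z | z ∈ V ∧ ReflTransGen (addLink r x y) a z} = {z | z ∈ V ∧ ReflTransGen r a z} := by
      intro a h1 h2
      ext z
      simp [reflTransGen_addLink_iff, h1, h2]
    ext C
    constructor
    · rintro ⟨a, ha, rfl⟩
      by_cases h1 : ReflTransGen r a x
      · exact .inl (key a (.inl h1))
      by_cases h2 : ReflTransGen r a y
      · exact .inl (key a (.inr h2))
      exact .inr ⟨a, ha, h1, h2, key2 a h1 h2⟩
    · rintro (rfl | ⟨a, ha, h1, h2, rfl⟩)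
      · exact ⟨x, hx, (key x (.inl .refl)).symm⟩
      · exact ⟨a, ha, (key2 a h1 h2).symm⟩
  have hxX : x ∈ X := ⟨hx, .refl⟩
  have hyY : y ∈ Y := ⟨hy, .refl⟩
  have n1 : X ∪ Y ∉ R := by
    rintro ⟨z, -, h1, -, he⟩
    exact h1 ((he ▸ Set.mem_union_left Y hxX : x ∈ {w | w ∈ V ∧ ReflTransGen r z w}).2)
  have n2 : Y ∉ R := by
    rintro ⟨z, -, -, h1, he⟩
    exact h1 ((he ▸ hyY : y ∈ {w | w ∈ V ∧ ReflTransGen r z w}).2)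
  have n3 : X ∉ insert Y R := by
    rintro (he | ⟨z, -, h1, -, he⟩)
    · exact h (he ▸ hyY : y ∈ X).2
    · exact h1 ((he ▸ hxX : x ∈ {w | w ∈ V ∧ ReflTransGen r z w}).2)
  unfold comps
  rw [e1, e2, Set.ncard_insert_of_notMem n1 hfin, Set.ncard_insert_of_notMem n3 (hfin.insert _),
    Set.ncard_insert_of_notMem n2 hfin]

theorem eq_of_reflTransGen_of_notMem {V : Set α} {r : α → α → Prop}
    (hr : ∀ a b, r a b → a ∈ V ∧ b ∈ V) {x y : α} (h : ReflTransGen r x y)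
    (hxy : x ∉ V ∨ y ∉ V) : x = y := by
  rcases hxy with hx | hy
  · rcases h.cases_head with h | ⟨c, h, -⟩
    exacts [h, absurd (hr _ _ h).1 hx]
  · rcases h.cases_tail with h | ⟨c, -, h⟩
    exacts [h.symm, absurd (hr _ _ h).2 hy]

theorem comps_insert {V : Set α} (hV : V.Finite) {r : α → α → Prop}
    (hr : ∀ a b, r a b → a ∈ V ∧ b ∈ V) {w : α} (hw : w ∉ V) :
    comps (insert w V) r = comps V r + 1 := by
  have e : {C : Set α | ∃ x ∈ insert w V, C = {y | y ∈ insert w V ∧ ReflTransGen r x y}} =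
      insert {w} {C : Set α | ∃ x ∈ V, C = {y | y ∈ V ∧ ReflTransGen r x y}} := by
    have k1 : {y | y ∈ insert w V ∧ ReflTransGen r w y} = {w} := by
      ext y
      constructor
      · rintro ⟨-, h⟩
        exact (eq_of_reflTransGen_of_notMem hr h (.inl hw)).symm
      · rintro rfl
        exact ⟨.inl rfl, .refl⟩
    have k2 : ∀ x ∈ V, {y | y ∈ insert w V ∧ ReflTransGen r x y} =
        {y | y ∈ V ∧ ReflTransGen r x y} := by
      intro x hx
      ext y
      constructor
      · rintro ⟨rfl | h, h'⟩
        · exact absurd hx (eq_of_reflTransGen_of_notMem hr h' (.inr hw) ▸ hw)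
        · exact ⟨h, h'⟩
      · rintro ⟨h, h'⟩
        exact ⟨.inr h, h'⟩
    ext C
    constructor
    · rintro ⟨x, rfl | hx, rfl⟩
      exacts [.inl k1, .inr ⟨x, hx, k2 x hx⟩]
    · rintro (rfl | ⟨x, hx, rfl⟩)
      exacts [⟨w, .inl rfl, k1.symm⟩, ⟨x, .inr hx, (k2 x hx).symm⟩]
  have hfin : {C : Set α | ∃ x ∈ V, C = {y | y ∈ V ∧ ReflTransGen r x y}}.Finite :=
    hV.finite_subsets.subset <| by
      rintro C ⟨z, -, rfl⟩ a ha
      exact ha.1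
  unfold comps
  rw [e, Set.ncard_insert_of_notMem _ hfin]
  rintro ⟨x, -, he⟩
  exact hw ((he ▸ Set.mem_singleton w : w ∈ {y | y ∈ V ∧ ReflTransGen r x y}).1)

theorem comps_union {V U : Set α} (hV : V.Finite) (hU : U.Finite) (h : Disjoint V U)
    {r : α → α → Prop} (hr : ∀ a b, r a b → a ∈ V ∧ b ∈ V) :
    comps (V ∪ U) r = comps V r + U.ncard := by
  induction U, hU using Set.Finite.induction_on with
  | empty => simp
  | @insert a s ha hs ih =>
    have h' := Set.disjoint_insert_right.1 h
    rw [Set.union_insert, comps_insert (hV.union hs) (fun a b hab =>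
        ⟨.inl (hr a b hab).1, .inl (hr a b hab).2⟩), ih h'.2, Set.ncard_insert_of_notMem ha hs]
    · rfl
    · rintro (h1 | h1)
      exacts [h'.1 h1, ha h1]

theorem comps_of_forall_not {V : Set α} (hV : V.Finite) {r : α → α → Prop}
    (hr : ∀ a b, ¬ r a b) : comps V r = V.ncard := by
  have h0 : comps (∅ : Set α) r = 0 := by simp [comps]
  have := comps_union (V := ∅) (U := V) Set.finite_empty hV (by simp) (r := r)
    (fun a b h => absurd h (hr a b))
  rwa [h0, Set.empty_union, zero_add] at this

/-- A walk in a union of two relations between points of the second part can be replaced by a walk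
in any extension of the second relation that joins those points of the intersection
that are joined by the first relation. -/
theorem reflTransGen_of_union {V₁ V₂ : Set α} {r₁ r₂ r : α → α → Prop}
    (h₁ : ∀ a b, r₁ a b → a ∈ V₁ ∧ b ∈ V₁) (h₂ : ∀ a b, r₂ a b → a ∈ V₂ ∧ b ∈ V₂)
    (hr : ∀ a b, r₂ a b → r a b)
    (hW : ∀ u ∈ V₁, u ∈ V₂ → ∀ w ∈ V₁, w ∈ V₂ → ReflTransGen r₁ u w → ReflTransGen r u w)
    {x y : α} (hx : x ∈ V₂) (hy : y ∈ V₂)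
    (h : ReflTransGen (fun a b => r₁ a b ∨ r₂ a b) x y) : ReflTransGen r x y := by
  -- While the walk is inside `V₁`, remember the point `u` of `V₁ ∩ V₂` at which its current
  -- `r₁`-stretch began; `hW` replaces that stretch once it is back in `V₂`.
  have key : (y ∈ V₂ → ReflTransGen r x y) ∧
      (y ∈ V₁ → ∃ u ∈ V₁, u ∈ V₂ ∧ ReflTransGen r x u ∧ ReflTransGen r₁ u y) := by
    clear hy
    induction h with
    | refl => exact ⟨fun _ => .refl, fun h => ⟨x, h, hx, .refl, .refl⟩⟩
    | @tail b c _ hbc ih =>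
      rcases hbc with hbc | hbc
      · obtain ⟨hb, hc⟩ := h₁ _ _ hbc
        obtain ⟨u, hu1, hu2, hxu, hub⟩ := ih.2 hb
        exact ⟨fun hc2 => hxu.trans (hW u hu1 hu2 c hc hc2 (hub.tail hbc)),
          fun _ => ⟨u, hu1, hu2, hxu, hub.tail hbc⟩⟩
      · obtain ⟨hb, hc⟩ := h₂ _ _ hbc
        have := (ih.1 hb).tail (hr _ _ hbc)
        exact ⟨fun _ => this, fun hc1 => ⟨c, hc1, hc, this, .refl⟩⟩
  exact key.1 hy

end relations

/-! ### Connectivity and component counts of spanning subgraphs. -/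

section links

variable {α β : Type*} {G : Graph α β}

/-- The adjacency relation of the spanning subgraph with edge set `A`. -/
def linked (G : Graph α β) (A : Set β) (a b : α) : Prop := ∃ e ∈ A, G.IsLink e a b

theorem linked_symm (A : Set β) (a b : α) (h : linked G A a b) : linked G A b a :=
  let ⟨e, he, h⟩ := h; ⟨e, he, h.symm⟩

theorem linked_mem (A : Set β) (a b : α) (h : linked G A a b) : a ∈ V(G) ∧ b ∈ V(G) :=
  let ⟨_, _, h⟩ := h; ⟨h.left_mem, h.right_mem⟩

theorem linked_union (A B : Set β) :
    linked G (A ∪ B) = fun a b => linked G A a b ∨ linked G B a b := by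
  ext a b
  simp only [linked, Set.mem_union, or_and_right, exists_or]

theorem linked_insert {e : β} {x y : α} (h : G.IsLink e x y) (A : Set β) :
    linked G (insert e A) = addLink (linked G A) x y := by
  ext a b
  simp only [linked, Set.mem_insert_iff, or_and_right, exists_or, exists_eq_left, addLink,
    h.isLink_iff]
  grind

theorem linked_empty (a b : α) : ¬ linked G ∅ a b := by simp [linked]

theorem linked_of_le {H : Graph α β} (h : H ≤ G) {A : Set β} (hA : A ⊆ E(H)) :
    linked H A = linked G A := by
  ext a b
  exact exists_congr fun e => and_congr_right fun he => h.isLink_iff (hA he)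

theorem conn_def (A : Set β) (x y : α) : Conn G A x y ↔ ReflTransGen (linked G A) x y := Iff.rfl

theorem numComponents_eq (A : Set β) : numComponents G A = comps V(G) (linked G A) := rfl

theorem Conn.symm {A : Set β} {x y : α} (h : Conn G A x y) : Conn G A y x :=
  reflTransGen_symm (linked_symm A) h

theorem Conn.mono {A B : Set β} {x y : α} (hAB : A ⊆ B) (h : Conn G A x y) : Conn G B x y :=
  ReflTransGen.mono (fun _ _ ⟨e, he, hl⟩ => ⟨e, hAB he, hl⟩) _ _ h

theorem numComponents_insert_of_conn {e : β} {x y : α} (h : G.IsLink e x y) {A : Set β}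
    (hA : Conn G A x y) : numComponents G (insert e A) = numComponents G A := by
  rw [numComponents_eq, linked_insert h, comps_addLink_of_conn (linked_symm A) hA, numComponents_eq]

theorem numComponents_insert_of_not_conn (hV : V(G).Finite) {e : β} {x y : α}
    (h : G.IsLink e x y) {A : Set β} (hA : ¬ Conn G A x y) :
    numComponents G (insert e A) + 1 = numComponents G A := by
  rw [numComponents_eq, linked_insert h,
    comps_addLink_of_not_conn hV (linked_symm A) h.left_mem h.right_mem hA, numComponents_eq]

end links

/-! ### Connectivity and component counts in a union of two subgraphs. -/

section unions

variable {α β : Type*} {G H₁ H₂ : Graph α β}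

theorem linked_union_of_le (h₁ : H₁ ≤ G) (h₂ : H₂ ≤ G) {A B : Set β} (hA : A ⊆ E(H₁))
    (hB : B ⊆ E(H₂)) : linked G (A ∪ B) = fun a b => linked H₁ A a b ∨ linked H₂ B a b := by
  rw [linked_union, linked_of_le h₁ hA, linked_of_le h₂ hB]

theorem Conn.of_le {H G : Graph α β} (h : H ≤ G) {A : Set β} {x y : α} (hA : Conn H A x y) :
    Conn G A x y :=
  ReflTransGen.mono (fun _ _ ⟨e, he, hl⟩ => ⟨e, he, hl.mono h⟩) _ _ hA

/-- If `A` joins no two different common vertices, every excursion of a walk into `H₁` returns to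
where it left `H₂` and can be cut out. -/
theorem conn_union_iff_right (h₁ : H₁ ≤ G) (h₂ : H₂ ≤ G) {A B : Set β} (hA : A ⊆ E(H₁))
    (hB : B ⊆ E(H₂))
    (hW : ∀ u ∈ V(H₁), u ∈ V(H₂) → ∀ w ∈ V(H₁), w ∈ V(H₂) → Conn H₁ A u w → u = w)
    {x y : α} (hx : x ∈ V(H₂)) (hy : y ∈ V(H₂)) :
    Conn G (A ∪ B) x y ↔ Conn H₂ B x y := by
  constructor
  · intro h
    rw [conn_def, linked_union_of_le h₁ h₂ hA hB] at h
    refine reflTransGen_of_union (linked_mem A) (linked_mem B) (fun _ _ => id) ?_ hx hy h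
    intro u hu hu' w hw hw' huw
    rw [hW u hu hu' w hw hw' huw]
  · intro h
    exact (h.of_le h₂).mono Set.subset_union_right

theorem conn_union_series_iff (h₁ : H₁ ≤ G) (h₂ : H₂ ≤ G) {A B : Set β} (hA : A ⊆ E(H₁))
    (hB : B ⊆ E(H₂)) {s m t : α} (hW : V(H₁) ∩ V(H₂) = {m}) (hs : s ∈ V(H₁)) (ht : t ∈ V(H₂)) :
    Conn G (A ∪ B) s t ↔ Conn H₁ A s m ∧ Conn H₂ B m t := by
  have hm : ∀ {c}, c ∈ V(H₁) → c ∈ V(H₂) → c = m := fun h h' => hW.subset ⟨h, h'⟩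
  constructor
  · intro h
    rw [conn_def, linked_union_of_le h₁ h₂ hA hB] at h
    -- A walk can change sides only at `m`, so both statements are carried along every prefix of the
    -- walk.
    have key : (t ∈ V(H₁) → Conn H₁ A s t) ∧
        (t ∈ V(H₂) → Conn H₁ A s m ∧ Conn H₂ B m t) := by
      clear ht
      induction h with
      | refl => exact ⟨fun _ => .refl, fun h => by rw [hm hs h]; exact ⟨.refl, .refl⟩⟩
      | @tail b c _ hbc ih =>
        rcases hbc with hbc | hbc
        · obtain ⟨hb, hc⟩ := linked_mem _ _ _ hbc
          have h' : Conn H₁ A s c := (ih.1 hb).tail hbc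
          refine ⟨fun _ => h', fun h => ?_⟩
          obtain rfl := hm hc h
          exact ⟨h', .refl⟩
        · obtain ⟨hb, hc⟩ := linked_mem _ _ _ hbc
          have h' := ih.2 hb
          refine ⟨fun h => ?_, fun h => ⟨h'.1, h'.2.tail hbc⟩⟩
          obtain rfl := hm h hc
          exact h'.1
    exact key.2 ht
  · rintro ⟨h, h'⟩
    exact ((h.of_le h₁).mono Set.subset_union_left).trans
      ((h'.of_le h₂).mono Set.subset_union_right)

theorem conn_union_parallel_iff (h₁ : H₁ ≤ G) (h₂ : H₂ ≤ G) {A B : Set β} (hA : A ⊆ E(H₁))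
    (hB : B ⊆ E(H₂)) {s t : α} (hW : V(H₁) ∩ V(H₂) = {s, t}) :
    Conn G (A ∪ B) s t ↔ Conn H₁ A s t ∨ Conn H₂ B s t := by
  have hs : s ∈ V(H₁) ∩ V(H₂) := hW ▸ Set.mem_insert s {t}
  have ht : t ∈ V(H₁) ∩ V(H₂) := hW ▸ Set.mem_insert_of_mem s rfl
  constructor
  · intro h
    by_cases h' : Conn H₁ A s t
    · exact .inl h'
    refine .inr ((conn_union_iff_right h₁ h₂ hA hB ?_ hs.2 ht.2).1 h)
    intro u hu hu' w hw hw' huw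
    rcases hW.subset ⟨hu, hu'⟩ with rfl | rfl <;> rcases hW.subset ⟨hw, hw'⟩ with rfl | rfl
    exacts [rfl, absurd huw h', absurd huw.symm h', rfl]
  · rintro (h | h)
    exacts [(h.of_le h₁).mono Set.subset_union_left, (h.of_le h₂).mono Set.subset_union_right]

/-- The relation `ρ` records what `A` does to connectivity between vertices of `H₂`. Adding the
edges of `B` one at a time, the count in `G` and the count in `H₂` with `ρ` drop at the same moments
by `hc`, so their difference keeps its value at `B = ∅`. -/
theorem numComponents_union_add (h₁ : H₁ ≤ G) (h₂ : H₂ ≤ G) (hV : V(H₁) ∪ V(H₂) = V(G))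
    (hf : V(G).Finite) {A : Set β} (hA : A ⊆ E(H₁)) {ρ : α → α → Prop}
    (hρ : ∀ a b, ρ a b → ρ b a)
    (hc : ∀ B ⊆ E(H₂), ∀ x ∈ V(H₂), ∀ y ∈ V(H₂),
      Conn G (A ∪ B) x y ↔ ReflTransGen (fun a b => linked H₂ B a b ∨ ρ a b) x y)
    (B : Finset β) (hB : (B : Set β) ⊆ E(H₂)) :
    numComponents G (A ∪ B) + comps V(H₂) ρ = numComponents H₁ A + (V(H₂) \ V(H₁)).ncard +
      comps V(H₂) (fun a b => linked H₂ B a b ∨ ρ a b) := by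
  classical
  have hf₂ : V(H₂).Finite := hf.subset h₂.vertexSet_mono
  induction B using Finset.induction_on with
  | empty =>
    have e : (fun a b => linked H₂ ((∅ : Finset β) : Set β) a b ∨ ρ a b) = ρ := by
      ext a b
      simp [linked]
    rw [e, Finset.coe_empty, Set.union_empty, numComponents_eq, ← linked_of_le h₁ hA, ← hV,
      ← Set.union_sdiff_self, comps_union (hf.subset h₁.vertexSet_mono) (hf₂.subset Set.sdiff_subset)
        Set.disjoint_sdiff_right (linked_mem A), numComponents_eq]
  | @insert e B he ih =>
    rw [Finset.coe_insert] at hB ⊢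
    have hB' := (Set.insert_subset_iff.1 hB).2
    obtain ⟨x, y, hxy⟩ := H₂.exists_isLink_of_mem_edgeSet (Set.insert_subset_iff.1 hB).1
    have e1 : (fun a b => linked H₂ (insert e (B : Set β)) a b ∨ ρ a b) =
        addLink (fun a b => linked H₂ B a b ∨ ρ a b) x y := by
      ext a b
      rw [linked_insert hxy]
      simp only [addLink]
      tauto
    have hs : ∀ a b, linked H₂ B a b ∨ ρ a b → linked H₂ B b a ∨ ρ b a :=
      fun a b => Or.imp (linked_symm _ _ _) (hρ _ _)
    have ih := ih hB'
    have hiff := hc B hB' x hxy.left_mem y hxy.right_mem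
    rw [Set.union_insert, e1]
    by_cases h : Conn G (A ∪ B) x y
    · rw [numComponents_insert_of_conn (hxy.mono h₂) h, comps_addLink_of_conn hs (hiff.1 h), ih]
    · have k1 := numComponents_insert_of_not_conn hf (hxy.mono h₂) h
      have k2 := comps_addLink_of_not_conn hf₂ hs hxy.left_mem hxy.right_mem (mt hiff.2 h)
      omega

theorem numComponents_union_of_forall (h₁ : H₁ ≤ G) (h₂ : H₂ ≤ G)
    (hV : V(H₁) ∪ V(H₂) = V(G)) (hf : V(G).Finite) {A : Set β} (hA : A ⊆ E(H₁))
    (hW : ∀ u ∈ V(H₁), u ∈ V(H₂) → ∀ w ∈ V(H₁), w ∈ V(H₂) → Conn H₁ A u w → u = w)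
    {B : Finset β} (hB : (B : Set β) ⊆ E(H₂)) :
    numComponents G (A ∪ B) + V(H₂).ncard = numComponents H₁ A + (V(H₂) \ V(H₁)).ncard +
      numComponents H₂ B := by
  have := numComponents_union_add h₁ h₂ hV hf hA (ρ := fun _ _ => False) (by simp)
    (fun B hB x hx y hy => by
      simpa using! conn_union_iff_right h₁ h₂ hA hB hW hx hy) B hB
  rw [comps_of_forall_not (hf.subset h₂.vertexSet_mono) (by simp)] at this
  simpa using! this

theorem numComponents_union_series (h₁ : H₁ ≤ G) (h₂ : H₂ ≤ G) (hV : V(H₁) ∪ V(H₂) = V(G))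
    (hf : V(G).Finite) {m : α} (hW : V(H₁) ∩ V(H₂) = {m}) {A B : Finset β}
    (hA : (A : Set β) ⊆ E(H₁)) (hB : (B : Set β) ⊆ E(H₂)) :
    numComponents G (A ∪ B) + 1 = numComponents H₁ A + numComponents H₂ B := by
  have k := numComponents_union_of_forall h₁ h₂ hV hf hA (fun u hu hu' w hw hw' _ =>
    (hW.subset ⟨hu, hu'⟩ : u = m).trans (hW.subset ⟨hw, hw'⟩ : w = m).symm) hB
  have k' := Set.ncard_inter_add_ncard_sdiff_eq_ncard V(H₂) V(H₁) (hf.subset h₂.vertexSet_mono)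
  rw [Set.inter_comm, hW, Set.ncard_singleton] at k'
  omega

-- Each of the two identifications of terminals merges two components, except that the second is
-- redundant when both sides already connect `s` to `t`. This explains the `1` and the `2`.
open Classical in
theorem numComponents_union_parallel (h₁ : H₁ ≤ G) (h₂ : H₂ ≤ G) (hV : V(H₁) ∪ V(H₂) = V(G))
    (hf : V(G).Finite) {s t : α} (hst : s ≠ t) (hW : V(H₁) ∩ V(H₂) = {s, t}) {A B : Finset β}
    (hA : (A : Set β) ⊆ E(H₁)) (hB : (B : Set β) ⊆ E(H₂)) :
    numComponents G (A ∪ B) + (if Conn H₁ A s t ∧ Conn H₂ B s t then 1 else 2) =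
      numComponents H₁ A + numComponents H₂ B := by
  have hf₂ := hf.subset h₂.vertexSet_mono
  have hs : s ∈ V(H₁) ∩ V(H₂) := hW ▸ Set.mem_insert s {t}
  have ht : t ∈ V(H₁) ∩ V(H₂) := hW ▸ Set.mem_insert_of_mem s rfl
  have k' := Set.ncard_inter_add_ncard_sdiff_eq_ncard V(H₂) V(H₁) (hf.subset h₂.vertexSet_mono)
  rw [Set.inter_comm, hW, Set.ncard_pair hst] at k'
  by_cases h : Conn H₁ A s t
  -- Seen from `H₂`, a set `A` that connects the terminals acts as one virtual edge between `s` and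
  -- `t`.
  · have k := numComponents_union_add h₁ h₂ hV hf hA (ρ := addLink (fun _ _ => False) s t)
      (addLink_symm (by simp) s t) (fun B hB x hx y hy => by
        constructor
        · intro hxy
          rw [conn_def, linked_union_of_le h₁ h₂ hA hB] at hxy
          refine reflTransGen_of_union (linked_mem _) (linked_mem B) (fun _ _ => .inl) ?_ hx hy hxy
          intro u hu hu' w hw hw' _
          rcases hW.subset ⟨hu, hu'⟩ with rfl | rfl <;> rcases hW.subset ⟨hw, hw'⟩ with rfl | rfl
          · exact .refl
          · exact .single (.inr (.inr (.inl ⟨rfl, rfl⟩)))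
          · exact .single (.inr (.inr (.inr ⟨rfl, rfl⟩)))
          · exact .refl
        · intro hxy
          have hst' : Conn G (A ∪ B) s t := (h.of_le h₁).mono Set.subset_union_left
          clear hx hy
          induction hxy with
          | refl => exact .refl
          | tail _ hbc ih =>
            rcases hbc with hbc | h0 | ⟨rfl, rfl⟩ | ⟨rfl, rfl⟩
            · exact ih.trans ((Conn.of_le h₂ (.single hbc)).mono Set.subset_union_right)
            · exact h0.elim
            · exact ih.trans hst'
            · exact ih.trans hst'.symm) B hB
    have e0 := comps_addLink_of_not_conn hf₂ (r := fun _ _ => False) (x := s) (y := t) (by simp)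
      hs.2 ht.2 (fun h => hst (eq_of_reflTransGen_of_notMem (V := ∅) (by simp) h (by simp)))
    rw [comps_of_forall_not hf₂ (r := fun _ _ => False) (by simp)] at e0
    have e1 : (fun a b => linked H₂ B a b ∨ addLink (fun _ _ => False) s t a b) =
        addLink (linked H₂ B) s t := by
      ext a b
      simp [addLink]
    rw [e1] at k
    by_cases h' : Conn H₂ B s t
    · rw [comps_addLink_of_conn (linked_symm _) h', ← numComponents_eq] at k
      rw [if_pos ⟨h, h'⟩]
      omega
    · have := comps_addLink_of_not_conn hf₂ (linked_symm _) hs.2 ht.2 h'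
      rw [← numComponents_eq] at this
      rw [if_neg (fun h => h' h.2)]
      omega
  · have k := numComponents_union_of_forall h₁ h₂ hV hf hA (by
      intro u hu hu' w hw hw' huw
      rcases hW.subset ⟨hu, hu'⟩ with rfl | rfl <;> rcases hW.subset ⟨hw, hw'⟩ with rfl | rfl
      exacts [rfl, absurd huw h, absurd huw.symm h, rfl]) hB
    rw [if_neg (fun h' => h h'.1)]
    omega

end unions

/-! ### Sums over subsets of a finite edge set. -/

section sums

variable {β : Type*}

open Classical in
theorem sum_powerset_union_of_disjoint {M : Type*} [AddCommMonoid M] {F₁ F₂ : Finset β}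
    (h : Disjoint F₁ F₂) (f : Finset β → M) :
    ∑ A ∈ (F₁ ∪ F₂).powerset, f A = ∑ A ∈ F₁.powerset, ∑ B ∈ F₂.powerset, f (A ∪ B) := by
  rw [← Finset.sum_product']
  symm
  refine Finset.sum_nbij' (fun p => p.1 ∪ p.2) (fun A => (A ∩ F₁, A ∩ F₂)) ?_ ?_ ?_ ?_ ?_
  · rintro ⟨A, B⟩ hp
    simp only [Finset.mem_product, Finset.mem_powerset] at hp ⊢
    exact Finset.union_subset_union hp.1 hp.2
  · intro A hA
    simp
  · rintro ⟨A, B⟩ hp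
    simp only [Finset.mem_product, Finset.mem_powerset] at hp
    have h1 := Finset.disjoint_left.1 h
    ext e
    · simp only [Finset.mem_inter, Finset.mem_union]
      have := @hp.1 e
      have := @hp.2 e
      have := @h1 e
      tauto
    · simp only [Finset.mem_inter, Finset.mem_union]
      have := @hp.1 e
      have := @hp.2 e
      have := @h1 e
      tauto
  · intro A hA
    rw [← Finset.inter_union_distrib_left]
    exact Finset.inter_eq_left.2 (Finset.mem_powerset.1 hA)
  · intros
    rfl

theorem finsum_subset_eq_sum {M : Type*} [AddCommMonoid M] {E : Set β} (hE : E.Finite)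
    (P : Finset β → Prop) [DecidablePred P] (f : Finset β → M) :
    ∑ᶠ A ∈ {A : Finset β | (A : Set β) ⊆ E ∧ P A}, f A =
      ∑ A ∈ hE.toFinset.powerset, if P A then f A else 0 := by
  rw [← Finset.sum_filter]
  have : {A : Finset β | (A : Set β) ⊆ E ∧ P A} =
      ((hE.toFinset.powerset.filter P : Finset (Finset β)) : Set (Finset β)) := by
    ext A
    simp [Set.Finite.subset_toFinset]
  rw [this, finsum_mem_coe_finset]

end sums

/-! ### Minimum cuts. -/

section flows

variable {α β : Type*} {G : Graph α β}

theorem not_conn_empty {x y : α} (h : x ≠ y) {A : Set β} (hA : A = ∅) : ¬ Conn G A x y := by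
  intro h'
  subst hA
  exact h (eq_of_reflTransGen_of_notMem (V := ∅) (by simp) h' (by simp))

theorem flow_le_card {x y : α} {C : Finset β} (hC : (C : Set β) ⊆ E(G))
    (h : ¬ Conn G (E(G) \ C) x y) : flow G x y ≤ C.card :=
  Nat.sInf_le ⟨C, hC, rfl, h⟩

/-- Deleting all edges separates distinct vertices, so the infimum is over a nonempty set and is
attained, rather than being the default value `0`. -/
theorem exists_card_eq_flow (hE : E(G).Finite) {x y : α} (hxy : x ≠ y) :
    ∃ C : Finset β, (C : Set β) ⊆ E(G) ∧ C.card = flow G x y ∧ ¬ Conn G (E(G) \ C) x y := by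
  refine Nat.sInf_mem (s := {n | ∃ C : Finset β, (C : Set β) ⊆ E(G) ∧ C.card = n ∧
    ¬ Conn G (E(G) \ C) x y}) ⟨_, hE.toFinset, ?_, rfl, not_conn_empty hxy ?_⟩ <;> simp

end flows

/-! ### Flows and effective weights under series and parallel composition. -/

namespace TwoTerminal

variable {α β : Type*} {K K₁ K₂ : TwoTerminal α β}

theorem sdiff_union_eq {E E₁ E₂ : Set β} (hE : E₁ ∪ E₂ = E) (hd : Disjoint E₁ E₂)
    {C₁ C₂ : Set β} (h₁ : C₁ ⊆ E₁) (h₂ : C₂ ⊆ E₂) :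
    E \ (C₁ ∪ C₂) = (E₁ \ C₁) ∪ (E₂ \ C₂) := by
  subst hE
  rw [Set.disjoint_left] at hd
  ext e
  have := @h₁ e
  have := @h₂ e
  have := @hd e
  simp only [Set.mem_sdiff, Set.mem_union]
  tauto

theorem sdiff_eq_sdiff_union_sdiff {E E₁ E₂ C : Set β} (hE : E₁ ∪ E₂ = E) :
    E \ C = (E₁ \ (C ∩ E₁)) ∪ (E₂ \ (C ∩ E₂)) := by
  subst hE
  ext e
  simp only [Set.mem_sdiff, Set.mem_union, Set.mem_inter_iff]
  tauto

theorem IsParallel.conn_iff (h : K.IsParallel K₁ K₂) {A B : Set β} (hA : A ⊆ E(K₁.graph))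
    (hB : B ⊆ E(K₂.graph)) :
    Conn K.graph (A ∪ B) K.s K.t ↔ Conn K₁.graph A K₁.s K₁.t ∨ Conn K₂.graph B K₂.s K₂.t := by
  rw [h.s_left, h.t_left, h.s_right, h.t_right]
  exact conn_union_parallel_iff h.le_left h.le_right hA hB h.inter_vertex

/-- A set of edges separates the terminals exactly when its traces on the two parts separate them in
both parts. -/
theorem IsParallel.terminalFlow_eq (h : K.IsParallel K₁ K₂) (hE : E(K.graph).Finite) :
    K.terminalFlow = K₁.terminalFlow + K₂.terminalFlow := by
  classical
  have hE₁ := hE.subset h.le_left.edgeSet_mono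
  have hE₂ := hE.subset h.le_right.edgeSet_mono
  refine le_antisymm ?_ ?_
  · obtain ⟨C₁, s₁, c₁, n₁⟩ := exists_card_eq_flow hE₁ K₁.s_ne_t
    obtain ⟨C₂, s₂, c₂, n₂⟩ := exists_card_eq_flow hE₂ K₂.s_ne_t
    calc K.terminalFlow ≤ (C₁ ∪ C₂).card := by
          refine flow_le_card ?_ ?_
          · rw [Finset.coe_union, ← h.union_edge]
            exact Set.union_subset_union s₁ s₂
          · rw [Finset.coe_union, sdiff_union_eq h.union_edge h.disjoint_edge s₁ s₂,
              h.conn_iff Set.sdiff_subset Set.sdiff_subset]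
            exact not_or.2 ⟨n₁, n₂⟩
      _ ≤ C₁.card + C₂.card := Finset.card_union_le _ _
      _ = _ := by rw [c₁, c₂]; rfl
  · obtain ⟨C, s, c, n⟩ := exists_card_eq_flow hE K.s_ne_t
    rw [sdiff_eq_sdiff_union_sdiff h.union_edge, h.conn_iff Set.sdiff_subset Set.sdiff_subset,
      not_or] at n
    have e₁ : ((C.filter (· ∈ E(K₁.graph)) : Finset β) : Set β) = ↑C ∩ E(K₁.graph) := by
      ext; simp
    have e₂ : ((C.filter (· ∈ E(K₂.graph)) : Finset β) : Set β) = ↑C ∩ E(K₂.graph) := by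
      ext; simp
    calc K₁.terminalFlow + K₂.terminalFlow
        ≤ (C.filter (· ∈ E(K₁.graph))).card + (C.filter (· ∈ E(K₂.graph))).card := by
          refine add_le_add (flow_le_card ?_ ?_) (flow_le_card ?_ ?_)
          · rw [e₁]; exact Set.inter_subset_right
          · rw [e₁]; exact n.1
          · rw [e₂]; exact Set.inter_subset_right
          · rw [e₂]; exact n.2
      _ = (C.filter (· ∈ E(K₁.graph)) ∪ C.filter (· ∈ E(K₂.graph))).card := by
          rw [Finset.card_union_of_disjoint]
          rw [← Finset.disjoint_coe, e₁, e₂]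
          exact h.disjoint_edge.mono Set.inter_subset_right Set.inter_subset_right
      _ ≤ C.card := Finset.card_le_card
          (Finset.union_subset (Finset.filter_subset _ _) (Finset.filter_subset _ _))
      _ = K.terminalFlow := c

theorem IsSeries.conn_iff (h : K.IsSeries K₁ K₂) {A B : Set β} (hA : A ⊆ E(K₁.graph))
    (hB : B ⊆ E(K₂.graph)) :
    Conn K.graph (A ∪ B) K.s K.t ↔ Conn K₁.graph A K₁.s K₁.t ∧ Conn K₂.graph B K₂.s K₂.t := by
  rw [← h.middle, ← h.s_left, ← h.t_right]
  exact conn_union_series_iff h.le_left h.le_right hA hB h.inter_vertex K₁.s_mem K₂.t_mem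

/-- A set of edges separates the terminals exactly when its trace on at least one part does so
there. -/
theorem IsSeries.terminalFlow_eq (h : K.IsSeries K₁ K₂) (hE : E(K.graph).Finite) :
    K.terminalFlow = min K₁.terminalFlow K₂.terminalFlow := by
  classical
  have hE₁ := hE.subset h.le_left.edgeSet_mono
  have hE₂ := hE.subset h.le_right.edgeSet_mono
  refine le_antisymm (le_min ?_ ?_) ?_
  · obtain ⟨C₁, s₁, c₁, n₁⟩ := exists_card_eq_flow hE₁ K₁.s_ne_t
    refine (flow_le_card (s₁.trans h.le_left.edgeSet_mono) ?_).trans c₁.le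
    have := sdiff_union_eq h.union_edge h.disjoint_edge s₁ (Set.empty_subset _)
    rw [Set.union_empty] at this
    rw [this, h.conn_iff Set.sdiff_subset Set.sdiff_subset]
    exact fun h => n₁ h.1
  · obtain ⟨C₂, s₂, c₂, n₂⟩ := exists_card_eq_flow hE₂ K₂.s_ne_t
    refine (flow_le_card (s₂.trans h.le_right.edgeSet_mono) ?_).trans c₂.le
    have := sdiff_union_eq h.union_edge h.disjoint_edge (Set.empty_subset _) s₂
    rw [Set.empty_union] at this
    rw [this, h.conn_iff Set.sdiff_subset Set.sdiff_subset]
    exact fun h => n₂ h.2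
  · obtain ⟨C, s, c, n⟩ := exists_card_eq_flow hE K.s_ne_t
    rw [sdiff_eq_sdiff_union_sdiff h.union_edge, h.conn_iff Set.sdiff_subset Set.sdiff_subset,
      not_and_or] at n
    rw [terminalFlow, terminalFlow, terminalFlow, ← c]
    rcases n with n | n
    · have e₁ : ((C.filter (· ∈ E(K₁.graph)) : Finset β) : Set β) = ↑C ∩ E(K₁.graph) := by
        ext; simp
      refine (min_le_left _ _).trans ((flow_le_card ?_ ?_).trans
        (Finset.card_le_card (Finset.filter_subset (· ∈ E(K₁.graph)) C)))
      · rw [e₁]; exact Set.inter_subset_right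
      · rw [e₁]; exact n
    · have e₁ : ((C.filter (· ∈ E(K₂.graph)) : Finset β) : Set β) = ↑C ∩ E(K₂.graph) := by
        ext; simp
      refine (min_le_right _ _).trans ((flow_le_card ?_ ?_).trans
        (Finset.card_le_card (Finset.filter_subset (· ∈ E(K₂.graph)) C)))
      · rw [e₁]; exact Set.inter_subset_right
      · rw [e₁]; exact n

open Classical in
theorem tutteDisc_eq_sum (hE : E(K.graph).Finite) (q : ℂ) (v : β → ℂ) :
    K.tutteDisc q v = ∑ A ∈ hE.toFinset.powerset,
      if ¬ Conn K.graph A K.s K.t then q ^ numComponents K.graph A * ∏ e ∈ A, v e else 0 :=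
  finsum_subset_eq_sum hE _ _

open Classical in
theorem tutteConn_eq_sum (hE : E(K.graph).Finite) (q : ℂ) (v : β → ℂ) :
    K.tutteConn q v = ∑ A ∈ hE.toFinset.powerset,
      if Conn K.graph A K.s K.t then q ^ numComponents K.graph A * ∏ e ∈ A, v e else 0 :=
  finsum_subset_eq_sum hE _ _

theorem toFinset_eq_union [DecidableEq β] {E E₁ E₂ : Set β} (hE : E.Finite) (h : E₁ ∪ E₂ = E)
    (hE₁ : E₁.Finite) (hE₂ : E₂.Finite) : hE.toFinset = hE₁.toFinset ∪ hE₂.toFinset := by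
  subst h
  ext
  simp

/-- Subsets of edges are pairs of subsets of the parts. The factor `q` compensates for the one
component lost in gluing at the middle vertex; the terminals are connected only if both parts
connect theirs. -/
theorem IsSeries.tutte_mul (h : K.IsSeries K₁ K₂) (hV : V(K.graph).Finite)
    (hE : E(K.graph).Finite) (q : ℂ) (v : β → ℂ) :
    K.tutteConn q v * q = K₁.tutteConn q v * K₂.tutteConn q v ∧
    K.tutteDisc q v * q = K₁.tutteDisc q v * K₂.tutteDisc q v +
      K₁.tutteDisc q v * K₂.tutteConn q v + K₁.tutteConn q v * K₂.tutteDisc q v := by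
  classical
  have hE₁ := hE.subset h.le_left.edgeSet_mono
  have hE₂ := hE.subset h.le_right.edgeSet_mono
  have hd : Disjoint hE₁.toFinset hE₂.toFinset := by
    simpa [← Finset.disjoint_coe] using h.disjoint_edge
  have term : ∀ A ∈ hE₁.toFinset.powerset, ∀ B ∈ hE₂.toFinset.powerset,
      q ^ numComponents K.graph ↑(A ∪ B) * (∏ e ∈ A ∪ B, v e) * q =
        (q ^ numComponents K₁.graph A * ∏ e ∈ A, v e) *
          (q ^ numComponents K₂.graph B * ∏ e ∈ B, v e) := by
    intro A hA B hB
    rw [Finset.mem_powerset] at hA hB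
    rw [Finset.prod_union (hd.mono hA hB), Finset.coe_union]
    have := numComponents_union_series h.le_left h.le_right h.union_vertex hV h.inter_vertex
      (Set.Finite.subset_toFinset.1 hA) (Set.Finite.subset_toFinset.1 hB)
    rw [mul_mul_mul_comm, ← pow_add, ← this]
    ring
  have iff₀ : ∀ A ∈ hE₁.toFinset.powerset, ∀ B ∈ hE₂.toFinset.powerset,
      (Conn K.graph ↑(A ∪ B) K.s K.t ↔ Conn K₁.graph A K₁.s K₁.t ∧ Conn K₂.graph B K₂.s K₂.t) := by
    intro A hA B hB
    rw [Finset.mem_powerset] at hA hB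
    rw [Finset.coe_union]
    exact h.conn_iff (Set.Finite.subset_toFinset.1 hA) (Set.Finite.subset_toFinset.1 hB)
  constructor
  · rw [tutteConn_eq_sum hE, tutteConn_eq_sum hE₁, tutteConn_eq_sum hE₂,
      toFinset_eq_union hE h.union_edge hE₁ hE₂, sum_powerset_union_of_disjoint hd,
      Finset.sum_mul_sum, Finset.sum_mul]
    refine Finset.sum_congr rfl fun A hA => ?_
    rw [Finset.sum_mul]
    refine Finset.sum_congr rfl fun B hB => ?_
    have t := term A hA B hB
    have i := iff₀ A hA B hB
    by_cases a : Conn K₁.graph A K₁.s K₁.t <;> by_cases b : Conn K₂.graph B K₂.s K₂.t <;>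
      simp only [i, a, b, t, if_true, if_false, and_true, and_false, mul_zero, zero_mul]
  · rw [tutteConn_eq_sum hE₁, tutteConn_eq_sum hE₂, tutteDisc_eq_sum hE, tutteDisc_eq_sum hE₁,
      tutteDisc_eq_sum hE₂,
      toFinset_eq_union hE h.union_edge hE₁ hE₂, sum_powerset_union_of_disjoint hd,
      Finset.sum_mul_sum, Finset.sum_mul_sum, Finset.sum_mul_sum, Finset.sum_mul,
      ← Finset.sum_add_distrib, ← Finset.sum_add_distrib]
    refine Finset.sum_congr rfl fun A hA => ?_
    rw [Finset.sum_mul, ← Finset.sum_add_distrib, ← Finset.sum_add_distrib]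
    refine Finset.sum_congr rfl fun B hB => ?_
    have t := term A hA B hB
    have i := iff₀ A hA B hB
    by_cases a : Conn K₁.graph A K₁.s K₁.t <;> by_cases b : Conn K₂.graph B K₂.s K₂.t <;>
      simp only [i, a, b, t, if_true, if_false, and_true, and_false, mul_zero, zero_mul, not_true,
        not_false_eq_true, add_zero, zero_add]

/-- Gluing at both terminals loses two components, hence `q ^ 2`, except when both parts connect the
terminals: then only one is lost, which gives the extra `q` in the last term. -/
theorem IsParallel.tutte_mul (h : K.IsParallel K₁ K₂) (hV : V(K.graph).Finite)
    (hE : E(K.graph).Finite) (q : ℂ) (v : β → ℂ) :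
    K.tutteDisc q v * q ^ 2 = K₁.tutteDisc q v * K₂.tutteDisc q v ∧
    K.tutteConn q v * q ^ 2 = K₁.tutteDisc q v * K₂.tutteConn q v +
      K₁.tutteConn q v * K₂.tutteDisc q v + K₁.tutteConn q v * K₂.tutteConn q v * q := by
  classical
  have hE₁ := hE.subset h.le_left.edgeSet_mono
  have hE₂ := hE.subset h.le_right.edgeSet_mono
  have hd : Disjoint hE₁.toFinset hE₂.toFinset := by
    simpa [← Finset.disjoint_coe] using h.disjoint_edge
  have term : ∀ A ∈ hE₁.toFinset.powerset, ∀ B ∈ hE₂.toFinset.powerset,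
      q ^ numComponents K.graph ↑(A ∪ B) * (∏ e ∈ A ∪ B, v e) *
        (if Conn K₁.graph A K₁.s K₁.t ∧ Conn K₂.graph B K₂.s K₂.t then q else q ^ 2) =
        (q ^ numComponents K₁.graph A * ∏ e ∈ A, v e) *
          (q ^ numComponents K₂.graph B * ∏ e ∈ B, v e) := by
    intro A hA B hB
    rw [Finset.mem_powerset] at hA hB
    rw [Finset.prod_union (hd.mono hA hB), Finset.coe_union]
    have := numComponents_union_parallel h.le_left h.le_right h.union_vertex hV K.s_ne_t
      h.inter_vertex
      (Set.Finite.subset_toFinset.1 hA) (Set.Finite.subset_toFinset.1 hB)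
    rw [h.s_left, h.t_left, h.s_right, h.t_right, mul_mul_mul_comm, ← pow_add, ← this]
    split_ifs <;> ring
  have iff₀ : ∀ A ∈ hE₁.toFinset.powerset, ∀ B ∈ hE₂.toFinset.powerset,
      (Conn K.graph ↑(A ∪ B) K.s K.t ↔ Conn K₁.graph A K₁.s K₁.t ∨ Conn K₂.graph B K₂.s K₂.t) := by
    intro A hA B hB
    rw [Finset.mem_powerset] at hA hB
    rw [Finset.coe_union]
    exact h.conn_iff (Set.Finite.subset_toFinset.1 hA) (Set.Finite.subset_toFinset.1 hB)
  constructor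
  · rw [tutteDisc_eq_sum hE, tutteDisc_eq_sum hE₁, tutteDisc_eq_sum hE₂,
      toFinset_eq_union hE h.union_edge hE₁ hE₂, sum_powerset_union_of_disjoint hd,
      Finset.sum_mul_sum, Finset.sum_mul]
    refine Finset.sum_congr rfl fun A hA => ?_
    rw [Finset.sum_mul]
    refine Finset.sum_congr rfl fun B hB => ?_
    have t := term A hA B hB
    have i := iff₀ A hA B hB
    by_cases a : Conn K₁.graph A K₁.s K₁.t <;> by_cases b : Conn K₂.graph B K₂.s K₂.t <;>
      simp only [a, b, if_true, if_false, and_true, and_false] at t <;>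
      simp only [i, a, b, ← t, if_true, if_false, mul_zero, zero_mul, not_true,
        not_false_eq_true, or_false, or_true]
  · rw [tutteConn_eq_sum hE, tutteConn_eq_sum hE₁, tutteConn_eq_sum hE₂, tutteDisc_eq_sum hE₁,
      tutteDisc_eq_sum hE₂,
      toFinset_eq_union hE h.union_edge hE₁ hE₂, sum_powerset_union_of_disjoint hd,
      Finset.sum_mul_sum, Finset.sum_mul_sum, Finset.sum_mul_sum, Finset.sum_mul, Finset.sum_mul,
      ← Finset.sum_add_distrib, ← Finset.sum_add_distrib]
    refine Finset.sum_congr rfl fun A hA => ?_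
    rw [Finset.sum_mul, Finset.sum_mul, ← Finset.sum_add_distrib, ← Finset.sum_add_distrib]
    refine Finset.sum_congr rfl fun B hB => ?_
    have t := term A hA B hB
    have i := iff₀ A hA B hB
    by_cases a : Conn K₁.graph A K₁.s K₁.t <;> by_cases b : Conn K₂.graph B K₂.s K₂.t <;>
      simp only [a, b, if_true, if_false, and_true, and_false] at t <;>
      simp only [i, a, b, ← t, if_true, if_false, mul_zero, zero_mul, not_true,
        not_false_eq_true, or_false, or_true, add_zero, zero_add]
    ring

/-- A division-free form, so that the composition rules become linear combinations of the product
identities. -/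
theorem effWeight_eq_some_iff {q : ℂ} (hq : q ≠ 0) (v : β → ℂ) (w : ℂ) :
    K.effWeight q v = some w ↔ K.tutteDisc q v ≠ 0 ∧ K.tutteConn q v * q = w * K.tutteDisc q v := by
  unfold effWeight
  split_ifs with h
  · simp [h]
  · simp only [Option.some.injEq, ne_eq, h, not_false_eq_true, true_and]
    constructor
    · rintro rfl
      field_simp
    · intro hw
      rw [div_div_div_eq, div_eq_iff (mul_ne_zero hq h)]
      linear_combination q * hw

theorem IsSeries.effWeight_eq (h : K.IsSeries K₁ K₂) (hV : V(K.graph).Finite)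
    (hE : E(K.graph).Finite) {q : ℂ} (hq : q ≠ 0) {v : β → ℂ} {a b w : ℂ}
    (ha : K₁.effWeight q v = some a) (hb : K₂.effWeight q v = some b)
    (hw : ser q a b = some w) : K.effWeight q v = some w := by
  rw [effWeight_eq_some_iff hq] at ha hb ⊢
  obtain ⟨hC, hD⟩ := h.tutte_mul hV hE q v
  unfold ser at hw
  split_ifs at hw with h0
  rw [Option.some.injEq, div_eq_iff h0] at hw
  -- Given that both parts have effective weights, the effective weight of the whole is defined
  -- exactly when `q + a + b ≠ 0`, that is, when `ser q a b` is.
  have hD' : K.tutteDisc q v * q ^ 2 = (q + a + b) * (K₁.tutteDisc q v * K₂.tutteDisc q v) := by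
    linear_combination q * hD + K₁.tutteDisc q v * hb.2 + K₂.tutteDisc q v * ha.2
  constructor
  · intro h'
    rw [h', zero_mul] at hD'
    exact mul_ne_zero h0 (mul_ne_zero ha.1 hb.1) hD'.symm
  · apply mul_right_cancel₀ (pow_ne_zero 2 hq)
    linear_combination q ^ 2 * hC - w * hD' + K₂.tutteConn q v * q * ha.2 +
      a * K₁.tutteDisc q v * hb.2 + K₁.tutteDisc q v * K₂.tutteDisc q v * hw

theorem IsParallel.effWeight_eq (h : K.IsParallel K₁ K₂) (hV : V(K.graph).Finite)
    (hE : E(K.graph).Finite) {q : ℂ} (hq : q ≠ 0) {v : β → ℂ} {a b : ℂ}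
    (ha : K₁.effWeight q v = some a) (hb : K₂.effWeight q v = some b) :
    K.effWeight q v = some (par a b) := by
  rw [effWeight_eq_some_iff hq] at ha hb ⊢
  obtain ⟨hD, hC⟩ := h.tutte_mul hV hE q v
  constructor
  · intro h'
    rw [h', zero_mul] at hD
    exact mul_ne_zero ha.1 hb.1 hD.symm
  · apply mul_right_cancel₀ (pow_ne_zero 2 hq)
    unfold par
    linear_combination q * hC - ((1 + a) * (1 + b) - 1) * hD + K₁.tutteDisc q v * hb.2 +
      K₂.tutteDisc q v * ha.2 + K₂.tutteConn q v * q * ha.2 + a * K₁.tutteDisc q v * hb.2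

theorem conn_iff_of_edge {e : β} (hl : K.graph.IsLink e K.s K.t) {A : Set β} (hA : A ⊆ {e}) :
    Conn K.graph A K.s K.t ↔ e ∈ A := by
  rcases Set.subset_singleton_iff_eq.1 hA with rfl | rfl
  · simpa using not_conn_empty K.s_ne_t rfl
  · exact ⟨fun _ => rfl, fun _ => .single ⟨e, rfl, hl⟩⟩

theorem terminalFlow_of_edge {e : β} (hE : E(K.graph) = {e}) (hl : K.graph.IsLink e K.s K.t) :
    K.terminalFlow = 1 := by
  refine le_antisymm ?_ ?_
  · refine (flow_le_card (C := {e}) (by simp [hE]) ?_).trans (by simp)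
    rw [conn_iff_of_edge hl (by simp [hE])]
    simp
  · obtain ⟨C, -, c, n⟩ := exists_card_eq_flow (hE ▸ Set.finite_singleton e) K.s_ne_t
    rw [Nat.one_le_iff_ne_zero]
    intro h0
    rw [terminalFlow, ← c, Finset.card_eq_zero] at h0
    subst h0
    rw [conn_iff_of_edge hl (by simp [hE])] at n
    simp [hE] at n

theorem effWeight_of_edge (hV : V(K.graph) = {K.s, K.t}) {e : β} (hE : E(K.graph) = {e})
    (hl : K.graph.IsLink e K.s K.t) {q : ℂ} (hq : q ≠ 0) (v : β → ℂ) :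
    K.effWeight q v = some (v e) := by
  classical
  have hf : E(K.graph).Finite := hE ▸ Set.finite_singleton e
  have hVf : V(K.graph).Finite := hV ▸ Set.toFinite _
  have e0 : hf.toFinset.powerset = {∅, {e}} := by
    have : hf.toFinset = {e} := by ext; simp [hE]
    rw [this]
    rfl
  have n0 : numComponents K.graph ∅ = 2 := by
    rw [numComponents_eq, comps_of_forall_not hVf linked_empty, hV, Set.ncard_pair K.s_ne_t]
  have n1 : numComponents K.graph {e} = 1 := by
    have := numComponents_insert_of_not_conn hVf hl (not_conn_empty (G := K.graph) K.s_ne_t rfl)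
    rw [n0] at this
    simpa using this
  have c0 : ¬ Conn K.graph ∅ K.s K.t := not_conn_empty K.s_ne_t rfl
  have c1 : Conn K.graph {e} K.s K.t := .single ⟨e, rfl, hl⟩
  have hne : (∅ : Finset β) ≠ {e} := (Finset.singleton_ne_empty e).symm
  rw [effWeight_eq_some_iff hq, tutteDisc_eq_sum hf, tutteConn_eq_sum hf, e0,
    Finset.sum_pair hne, Finset.sum_pair hne]
  simp only [c0, c1, not_true, not_false_eq_true, if_true, if_false, Finset.coe_empty, n0,
    Finset.coe_singleton, n1, Finset.prod_empty, Finset.prod_singleton]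
  exact ⟨by simpa using hq, by ring⟩

end TwoTerminal

/-! ### Series-parallel edge sets inside a fixed ambient graph, and their splittings. -/

section edgeSets

variable {α β : Type*} {G H : Graph α β}

/-- The vertices that are incident with an edge in `F`. -/
def ends (G : Graph α β) (F : Set β) : Set α := {x | ∃ e ∈ F, G.Inc e x}

theorem ends_mono {F F' : Set β} (h : F ⊆ F') : ends G F ⊆ ends G F' :=
  fun _ ⟨e, he, hx⟩ => ⟨e, h he, hx⟩

theorem ends_union (F F' : Set β) : ends G (F ∪ F') = ends G F ∪ ends G F' := by
  ext x
  simp only [ends, Set.mem_union, or_and_right, exists_or, Set.mem_ofPred_eq]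

theorem ends_of_le (h : H ≤ G) {F : Set β} (hF : F ⊆ E(H)) : ends H F = ends G F := by
  ext x
  exact exists_congr fun e => and_congr_right fun he => h.inc_congr (hF he)

theorem ends_edgeSet_subset (h : H ≤ G) : ends G E(H) ⊆ V(H) := by
  rw [← ends_of_le h subset_rfl]
  rintro x ⟨e, -, hx⟩
  exact hx.vertex_mem

/-- Connectedness rules out isolated vertices, so passing from a constituent to its edge set loses
nothing. -/
theorem IsConnected.mem_ends (h : IsConnected H) {x y : α} (hx : x ∈ V(H)) (hy : y ∈ V(H))
    (hxy : x ≠ y) : x ∈ ends H E(H) := by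
  rcases (h.2 x hx y hy).cases_head with h | ⟨z, ⟨e, he, hl⟩, -⟩
  exacts [absurd h hxy, ⟨e, he, hl.inc_left⟩]

/-- `F` is the edge set of a 2-terminal series-parallel subgraph of `G` with terminals `s`, `t`. -/
inductive SPEdges (G : Graph α β) : Set β → α → α → Prop
  | edge {e : β} {s t : α} : G.IsLink e s t → s ≠ t → SPEdges G {e} s t
  | series {F₁ F₂ : Set β} {s m t : α} : SPEdges G F₁ s m → SPEdges G F₂ m t →
      ends G F₁ ∩ ends G F₂ = {m} → SPEdges G (F₁ ∪ F₂) s t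
  | parallel {F₁ F₂ : Set β} {s t : α} : SPEdges G F₁ s t → SPEdges G F₂ s t →
      Disjoint F₁ F₂ → ends G F₁ ∩ ends G F₂ = {s, t} → SPEdges G (F₁ ∪ F₂) s t

namespace SPEdges

variable {F : Set β} {s t : α}

theorem terminals_mem (h : SPEdges G F s t) : s ∈ ends G F ∧ t ∈ ends G F := by
  induction h with
  | edge h _ => exact ⟨⟨_, rfl, h.inc_left⟩, ⟨_, rfl, h.inc_right⟩⟩
  | series _ _ _ ih₁ ih₂ =>
    exact ⟨ends_mono Set.subset_union_left ih₁.1, ends_mono Set.subset_union_right ih₂.2⟩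
  | parallel _ _ _ _ ih₁ _ =>
    exact ⟨ends_mono Set.subset_union_left ih₁.1, ends_mono Set.subset_union_left ih₁.2⟩

theorem ne (h : SPEdges G F s t) : s ≠ t := by
  induction h with
  | edge _ h => exact h
  | series h₁ h₂ hi ih₁ _ =>
    rintro rfl
    exact ih₁ (hi.subset ⟨h₁.terminals_mem.1, h₂.terminals_mem.2⟩)
  | parallel _ _ _ _ ih _ => exact ih

theorem nonempty (h : SPEdges G F s t) : F.Nonempty :=
  let ⟨e, he, _⟩ := h.terminals_mem.1
  ⟨e, he⟩

theorem subset (h : SPEdges G F s t) : F ⊆ E(G) := by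
  induction h with
  | edge h _ => exact Set.singleton_subset_iff.2 h.edge_mem
  | series _ _ _ ih₁ ih₂ => exact Set.union_subset ih₁ ih₂
  | parallel _ _ _ _ ih₁ ih₂ => exact Set.union_subset ih₁ ih₂

theorem finite (h : SPEdges G F s t) : F.Finite := by
  induction h with
  | edge h _ => exact Set.finite_singleton _
  | series _ _ _ ih₁ ih₂ => exact ih₁.union ih₂
  | parallel _ _ _ _ ih₁ ih₂ => exact ih₁.union ih₂

theorem ne_of_isLink (h : SPEdges G F s t) : ∀ e ∈ F, ∀ x y, G.IsLink e x y → x ≠ y := by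
  induction h with
  | edge h hne =>
    rintro e rfl x y hl rfl
    rcases hl.eq_and_eq_or_eq_and_eq h with ⟨rfl, rfl⟩ | ⟨rfl, rfl⟩ <;> exact hne rfl
  | series _ _ _ ih₁ ih₂ =>
    rintro e (he | he)
    exacts [ih₁ e he, ih₂ e he]
  | parallel _ _ _ _ ih₁ ih₂ =>
    rintro e (he | he)
    exacts [ih₁ e he, ih₂ e he]

/-- A common edge would have both ends equal to `m`, but series-parallel edge sets contain no loops.
For this reason `SPEdges.series` need not demand disjointness. -/
theorem disjoint_of_ends (h : SPEdges G F s t) {K₁ K₂ : Set β} (hK : K₁ ⊆ F) {m : α}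
    (hm : ends G K₁ ∩ ends G K₂ ⊆ {m}) : Disjoint K₁ K₂ := by
  rw [Set.disjoint_left]
  intro e h₁ h₂
  obtain ⟨x, y, hl⟩ := G.exists_isLink_of_mem_edgeSet (h.subset (hK h₁))
  exact h.ne_of_isLink e (hK h₁) x y hl <|
    (hm ⟨⟨e, h₁, hl.inc_left⟩, ⟨e, h₂, hl.inc_left⟩⟩ : x = m).trans
      (hm ⟨⟨e, h₁, hl.inc_right⟩, ⟨e, h₂, hl.inc_right⟩⟩ : y = m).symm

theorem mono (hle : H ≤ G) (h : SPEdges H F s t) : SPEdges G F s t := by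
  induction h with
  | edge h hne => exact .edge (h.mono hle) hne
  | series h₁ h₂ hi ih₁ ih₂ =>
    rw [ends_of_le hle h₁.subset, ends_of_le hle h₂.subset] at hi
    exact .series ih₁ ih₂ hi
  | parallel h₁ h₂ hd hi ih₁ ih₂ =>
    rw [ends_of_le hle h₁.subset, ends_of_le hle h₂.subset] at hi
    exact .parallel ih₁ ih₂ hd hi

theorem anti (hle : H ≤ G) (h : SPEdges G F s t) (hF : F ⊆ E(H)) : SPEdges H F s t := by
  induction h with
  | edge h hne => exact .edge ((hle.isLink_iff (hF rfl)).2 h) hne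
  | series h₁ h₂ hi ih₁ ih₂ =>
    have k₁ := Set.subset_union_left.trans hF
    have k₂ := Set.subset_union_right.trans hF
    rw [← ends_of_le hle k₁, ← ends_of_le hle k₂] at hi
    exact .series (ih₁ k₁) (ih₂ k₂) hi
  | parallel h₁ h₂ hd hi ih₁ ih₂ =>
    have k₁ := Set.subset_union_left.trans hF
    have k₂ := Set.subset_union_right.trans hF
    rw [← ends_of_le hle k₁, ← ends_of_le hle k₂] at hi
    exact .parallel (ih₁ k₁) (ih₂ k₂) hd hi

/-- A 2-terminal series-parallel graph cannot be cut at a terminal. -/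
theorem subset_or_subset (h : SPEdges G F s t) {K₁ K₂ : Set β} {u : α} (hF : F ⊆ K₁ ∪ K₂)
    (hu : u = s ∨ u = t ∨ u ∉ ends G F)
    (hK : ∀ x ∈ ends G F, x ∈ ends G K₁ → x ∈ ends G K₂ → x = u) : F ⊆ K₁ ∨ F ⊆ K₂ := by
  induction h with
  | edge => simpa using hF
  | @series F₁ F₂ s m t h₁ h₂ hi ih₁ ih₂ =>
    rw [ends_union] at hu hK
    have hs : s ∉ ends G F₂ := fun h => h₁.ne (hi.subset ⟨h₁.terminals_mem.1, h⟩)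
    have ht : t ∉ ends G F₁ := fun h => h₂.ne (hi.subset ⟨h, h₂.terminals_mem.2⟩).symm
    have k₁ := ih₁ (Set.subset_union_left.trans hF) (by
      rcases hu with rfl | rfl | hu
      exacts [.inl rfl, .inr (.inr ht), .inr (.inr fun h => hu (.inl h))])
      fun x hx => hK x (.inl hx)
    have k₂ := ih₂ (Set.subset_union_right.trans hF) (by
      rcases hu with rfl | rfl | hu
      exacts [.inr (.inr hs), .inr (.inl rfl), .inr (.inr fun h => hu (.inr h))])
      fun x hx => hK x (.inr hx)
    -- If the two factors fell on different sides, their joint `m` would meet both sides and would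
    -- have to be `u`; but `u` is a terminal or lies off `F`.
    have hmu : m ≠ u := by
      rintro rfl
      rcases hu with h | h | h
      exacts [h₁.ne h.symm, h₂.ne h, h (.inl h₁.terminals_mem.2)]
    rcases k₁ with k₁ | k₁ <;> rcases k₂ with k₂ | k₂
    · exact .inl (Set.union_subset k₁ k₂)
    · exact absurd (hK m (.inl h₁.terminals_mem.2) (ends_mono k₁ h₁.terminals_mem.2)
        (ends_mono k₂ h₂.terminals_mem.1)) hmu
    · exact absurd (hK m (.inl h₁.terminals_mem.2) (ends_mono k₂ h₂.terminals_mem.1)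
        (ends_mono k₁ h₁.terminals_mem.2)) hmu
    · exact .inr (Set.union_subset k₁ k₂)
  | @parallel F₁ F₂ s t h₁ h₂ hd hi ih₁ ih₂ =>
    rw [ends_union] at hu hK
    have k₁ := ih₁ (Set.subset_union_left.trans hF)
      (hu.imp_right (Or.imp_right fun h h' => h (.inl h'))) fun x hx => hK x (.inl hx)
    have k₂ := ih₂ (Set.subset_union_right.trans hF)
      (hu.imp_right (Or.imp_right fun h h' => h (.inr h'))) fun x hx => hK x (.inr hx)
    obtain ⟨s₁, t₁⟩ := h₁.terminals_mem
    obtain ⟨s₂, t₂⟩ := h₂.terminals_mem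
    -- Branches on different sides would make both `s` and `t` common to the sides, hence both equal
    -- to `u`.
    rcases k₁ with k₁ | k₁ <;> rcases k₂ with k₂ | k₂
    · exact .inl (Set.union_subset k₁ k₂)
    · exact absurd ((hK s (.inl s₁) (ends_mono k₁ s₁) (ends_mono k₂ s₂)).trans
        (hK t (.inl t₁) (ends_mono k₁ t₁) (ends_mono k₂ t₂)).symm) h₁.ne
    · exact absurd ((hK s (.inl s₁) (ends_mono k₂ s₂) (ends_mono k₁ s₁)).trans
        (hK t (.inl t₁) (ends_mono k₂ t₂) (ends_mono k₁ t₁)).symm) h₁.ne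
    · exact .inr (Set.union_subset k₁ k₂)

/-- Compare the given cut at `m` with the way `F` was built. In a series composition with joint `n`,
either `m = n` and the two splits agree, or `m` lies in just one factor, which is split by induction
while the other is absorbed whole. A parallel composition admits no such cut: some branch avoids
`m`, is therefore uncut, and joins `s` to `t` within one side. -/
theorem of_series (h : SPEdges G F s t) : ∀ {m : α} {K₁ K₂ : Set β}, F = K₁ ∪ K₂ →
    ends G K₁ ∩ ends G K₂ = {m} → s ∈ ends G K₁ → t ∈ ends G K₂ → m ≠ s → m ≠ t →
    SPEdges G K₁ s m ∧ SPEdges G K₂ m t := by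
  induction h with
  | @edge e s t hl hne =>
    intro m K₁ K₂ hF hm ⟨e₁, he₁, hs₁⟩ ⟨e₂, he₂, _⟩ hms _
    obtain rfl : e₁ = e := hF.symm.subset (.inl he₁)
    obtain rfl : e₂ = e₁ := hF.symm.subset (.inr he₂)
    exact absurd (hm.subset ⟨⟨e₂, he₁, hs₁⟩, ⟨e₂, he₂, hs₁⟩⟩ : s = m).symm hms
  | @series L₁ L₂ s n t h₁ h₂ hi ih₁ ih₂ =>
    intro m K₁ K₂ hF hm hs ht hms hmt
    have hLK : ∀ {e}, e ∈ L₁ ∨ e ∈ L₂ ↔ e ∈ K₁ ∨ e ∈ K₂ := fun {e} => Set.ext_iff.1 hF e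
    have hd : ∀ {e}, e ∈ K₁ → e ∈ K₂ → False := fun h => Set.disjoint_left.1
      ((SPEdges.series h₁ h₂ hi).disjoint_of_ends (hF ▸ Set.subset_union_left) hm.subset) h
    have hmem : m ∈ ends G K₁ ∩ ends G K₂ := hm ▸ rfl
    have hK : ∀ x, x ∈ ends G K₁ → x ∈ ends G K₂ → x = m := fun x h h' => hm.subset ⟨h, h'⟩
    obtain ⟨s₁, n₁⟩ := h₁.terminals_mem
    obtain ⟨n₂, t₂⟩ := h₂.terminals_mem
    -- A factor that does not have `m` in its interior cannot be cut at `m`; the terminal `s`, or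
    -- `t` for the other factor, tells on which side it lies.
    have c₁ : (m = n ∨ m ∉ ends G L₁) → L₁ ⊆ K₁ := by
      intro hu
      refine (h₁.subset_or_subset (hF ▸ Set.subset_union_left) (.inr hu)
        (fun x _ => hK x)).resolve_right fun h => ?_
      exact hms (hK s hs (ends_mono h s₁)).symm
    have c₂ : (m = n ∨ m ∉ ends G L₂) → L₂ ⊆ K₂ := by
      intro hu
      refine (h₂.subset_or_subset (hF ▸ Set.subset_union_right) (hu.imp_right .inr)
        (fun x _ => hK x)).resolve_left fun h => ?_
      exact hmt (hK t (ends_mono h t₂) ht).symm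
    by_cases m₂ : m ∈ ends G L₂
    · by_cases m₁ : m ∈ ends G L₁
      · obtain rfl : m = n := hi.subset ⟨m₁, m₂⟩
        have c₁ := c₁ (.inl rfl)
        have c₂ := c₂ (.inl rfl)
        have e₁ : K₁ = L₁ := by
          refine Set.Subset.antisymm (fun e he => ?_) c₁
          exact (hLK.2 (.inl he)).resolve_right fun h => hd he (c₂ h)
        have e₂ : K₂ = L₂ := by
          refine Set.Subset.antisymm (fun e he => ?_) c₂
          exact (hLK.2 (.inr he)).resolve_left fun h => hd (c₁ h) he
        rw [e₁, e₂]
        exact ⟨h₁, h₂⟩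
      · have c₁ := c₁ (.inr m₁)
        have e₂ : K₂ ⊆ L₂ := fun e he =>
          (hLK.2 (.inr he)).resolve_left fun h => hd (c₁ h) he
        have hn : n ∈ ends G (K₁ ∩ L₂) := by
          obtain ⟨e, he, hx⟩ := n₂
          rcases hLK.1 (.inr he) with h | h
          · exact ⟨e, ⟨h, he⟩, hx⟩
          · exact absurd (hK n (ends_mono c₁ n₁) ⟨e, h, hx⟩ ▸ n₁) m₁
        have hmL : m ∈ ends G (K₁ ∩ L₂) := by
          obtain ⟨e, he, hx⟩ := hmem.1
          rcases hLK.2 (.inl he) with h | h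
          · exact absurd ⟨e, h, hx⟩ m₁
          · exact ⟨e, ⟨he, h⟩, hx⟩
        obtain ⟨k₁, k₂⟩ := ih₂ (m := m) (K₁ := K₁ ∩ L₂) (K₂ := K₂) (by
            ext e
            have := @hLK e
            have := @e₂ e
            grind)
          (Set.Subset.antisymm (fun x hx => hK x (ends_mono Set.inter_subset_left hx.1) hx.2)
            (Set.singleton_subset_iff.2 ⟨hmL, hmem.2⟩)) hn ht (fun h => m₁ (h ▸ n₁)) hmt
        refine ⟨?_, k₂⟩
        have e₁ : K₁ = L₁ ∪ (K₁ ∩ L₂) := by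
          ext e
          have := @hLK e
          have := @c₁ e
          grind
        rw [e₁]
        refine .series h₁ k₁ (Set.Subset.antisymm (fun x hx =>
          hi.subset ⟨hx.1, ends_mono Set.inter_subset_right hx.2⟩)
            (Set.singleton_subset_iff.2 ⟨n₁, hn⟩))
    · have c₂ := c₂ (.inr m₂)
      have e₁ : K₁ ⊆ L₁ := fun e he =>
        (hLK.2 (.inl he)).resolve_right fun h => hd he (c₂ h)
      have hn : n ∈ ends G (K₂ ∩ L₁) := by
        obtain ⟨e, he, hx⟩ := n₁
        rcases hLK.1 (.inl he) with h | h
        · exact absurd (hK n ⟨e, h, hx⟩ (ends_mono c₂ n₂) ▸ n₂) m₂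
        · exact ⟨e, ⟨h, he⟩, hx⟩
      have hmL : m ∈ ends G (K₂ ∩ L₁) := by
        obtain ⟨e, he, hx⟩ := hmem.2
        rcases hLK.2 (.inr he) with h | h
        · exact ⟨e, ⟨he, h⟩, hx⟩
        · exact absurd ⟨e, h, hx⟩ m₂
      obtain ⟨k₁, k₂⟩ := ih₁ (m := m) (K₁ := K₁) (K₂ := K₂ ∩ L₁) (by
          ext e
          have := @hLK e
          have := @e₁ e
          grind)
        (Set.Subset.antisymm (fun x hx => hK x hx.1 (ends_mono Set.inter_subset_left hx.2))
          (Set.singleton_subset_iff.2 ⟨hmem.1, hmL⟩)) hs hn hms (fun h => m₂ (h ▸ n₂))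
      refine ⟨k₁, ?_⟩
      have e₂ : K₂ = (K₂ ∩ L₁) ∪ L₂ := by
        ext e
        have := @hLK e
        have := @c₂ e
        grind
      rw [e₂]
      refine .series k₂ h₂ (Set.Subset.antisymm (fun x hx =>
        hi.subset ⟨ends_mono Set.inter_subset_right hx.1, hx.2⟩)
          (Set.singleton_subset_iff.2 ⟨hn, n₂⟩))
  | @parallel L₁ L₂ s t h₁ h₂ hd hi ih₁ ih₂ =>
    intro m K₁ K₂ hF hm hs ht hms hmt
    exfalso
    have key : ∀ {L}, SPEdges G L s t → L ⊆ K₁ ∪ K₂ → m ∉ ends G L → False := by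
      intro L hL hLK hmL
      rcases hL.subset_or_subset hLK (.inr (.inr hmL)) (fun x _ h h' => hm.subset ⟨h, h'⟩)
        with h | h
      · exact hmt (hm.subset ⟨ends_mono h hL.terminals_mem.2, ht⟩ : t = m).symm
      · exact hms (hm.subset ⟨hs, ends_mono h hL.terminals_mem.1⟩ : s = m).symm
    by_cases m₁ : m ∈ ends G L₁
    · refine key h₂ (hF ▸ Set.subset_union_right) fun m₂ => ?_
      rcases hi.subset ⟨m₁, m₂⟩ with h | h
      exacts [hms h, hmt h]
    · exact key h₁ (hF ▸ Set.subset_union_left) m₁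

/-- In a series composition each factor lies on one side, since it has only one of `s`, `t` as an
end; the same side would leave the other empty, and different sides would share the joint. In a
parallel composition, split both branches along `K₁`, `K₂` by induction and regroup the pieces, some
of which may be empty. -/
theorem of_parallel (h : SPEdges G F s t) : ∀ {K₁ K₂ : Set β}, F = K₁ ∪ K₂ → Disjoint K₁ K₂ →
    ends G K₁ ∩ ends G K₂ ⊆ {s, t} → K₁.Nonempty → K₂.Nonempty →
    SPEdges G K₁ s t ∧ SPEdges G K₂ s t := by
  induction h with
  | @edge e s t hl hne =>
    intro K₁ K₂ hF hd _ ⟨e₁, he₁⟩ ⟨e₂, he₂⟩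
    obtain rfl : e₁ = e := hF.symm.subset (.inl he₁)
    obtain rfl : e₂ = e₁ := hF.symm.subset (.inr he₂)
    exact (Set.disjoint_left.1 hd he₁ he₂).elim
  | @series L₁ L₂ s n t h₁ h₂ hi ih₁ ih₂ =>
    intro K₁ K₂ hF hd hK ⟨e₁, he₁⟩ ⟨e₂, he₂⟩
    exfalso
    obtain ⟨s₁, n₁⟩ := h₁.terminals_mem
    obtain ⟨n₂, t₂⟩ := h₂.terminals_mem
    have hn : n ∈ ends G K₁ → n ∈ ends G K₂ → False := by
      intro h h'
      rcases hK ⟨h, h'⟩ with rfl | rfl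
      exacts [h₁.ne rfl, h₂.ne rfl]
    have k₁ : L₁ ⊆ K₁ ∨ L₁ ⊆ K₂ := by
      refine h₁.subset_or_subset (hF ▸ Set.subset_union_left) (.inl rfl) fun x hx h h' => ?_
      rcases hK ⟨h, h'⟩ with h | rfl
      exacts [h, absurd (hi.subset ⟨hx, t₂⟩).symm h₂.ne]
    have k₂ : L₂ ⊆ K₁ ∨ L₂ ⊆ K₂ := by
      refine h₂.subset_or_subset (hF ▸ Set.subset_union_right) (.inr (.inl rfl)) fun x hx h h' => ?_
      rcases hK ⟨h, h'⟩ with rfl | h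
      exacts [absurd (hi.subset ⟨s₁, hx⟩) h₁.ne, h]
    rcases k₁ with k₁ | k₁ <;> rcases k₂ with k₂ | k₂
    · exact Set.disjoint_left.1 hd (Set.union_subset k₁ k₂ (hF ▸ Or.inr he₂)) he₂
    · exact hn (ends_mono k₁ n₁) (ends_mono k₂ n₂)
    · exact hn (ends_mono k₂ n₂) (ends_mono k₁ n₁)
    · exact Set.disjoint_left.1 hd he₁ (Set.union_subset k₁ k₂ (hF ▸ Or.inl he₁))
  | @parallel L₁ L₂ s t h₁ h₂ hdL hi ih₁ ih₂ =>
    intro K₁ K₂ hF hd hK hn₁ hn₂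
    have piece : ∀ {L}, SPEdges G L s t → (∀ {K₁ K₂ : Set β}, L = K₁ ∪ K₂ → Disjoint K₁ K₂ →
        ends G K₁ ∩ ends G K₂ ⊆ {s, t} → K₁.Nonempty → K₂.Nonempty →
        SPEdges G K₁ s t ∧ SPEdges G K₂ s t) → L ⊆ K₁ ∪ K₂ →
        ((K₁ ∩ L).Nonempty → SPEdges G (K₁ ∩ L) s t) ∧
        ((K₂ ∩ L).Nonempty → SPEdges G (K₂ ∩ L) s t) := by
      intro L hL ih hLK
      have e : L = K₁ ∩ L ∪ K₂ ∩ L := by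
        rw [← Set.union_inter_distrib_right]
        exact (Set.inter_eq_right.2 hLK).symm
      rcases Set.eq_empty_or_nonempty (K₁ ∩ L) with h | h
      · rw [h, Set.empty_union] at e
        exact ⟨fun h' => absurd h h'.ne_empty, fun _ => e ▸ hL⟩
      rcases Set.eq_empty_or_nonempty (K₂ ∩ L) with h' | h'
      · rw [h', Set.union_empty] at e
        exact ⟨fun _ => e ▸ hL, fun h => absurd h' h.ne_empty⟩
      · have := ih e (hd.mono Set.inter_subset_left Set.inter_subset_left)
          ((Set.inter_subset_inter (ends_mono Set.inter_subset_left)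
            (ends_mono Set.inter_subset_left)).trans hK) h h'
        exact ⟨fun _ => this.1, fun _ => this.2⟩
    have join : ∀ {K : Set β}, K.Nonempty → K ⊆ L₁ ∪ L₂ →
        ((K ∩ L₁).Nonempty → SPEdges G (K ∩ L₁) s t) →
        ((K ∩ L₂).Nonempty → SPEdges G (K ∩ L₂) s t) → SPEdges G K s t := by
      intro K hne hKL k₁ k₂
      have e : K = K ∩ L₁ ∪ K ∩ L₂ := by
        rw [← Set.inter_union_distrib_left]
        exact (Set.inter_eq_left.2 hKL).symm
      rcases Set.eq_empty_or_nonempty (K ∩ L₁) with h | h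
      · rw [h, Set.empty_union] at e
        rw [e]
        exact k₂ (e ▸ hne)
      rcases Set.eq_empty_or_nonempty (K ∩ L₂) with h' | h'
      · rw [h', Set.union_empty] at e
        rw [e]
        exact k₁ (e ▸ hne)
      · have k₁ := k₁ h
        have k₂ := k₂ h'
        rw [e]
        refine .parallel k₁ k₂ (hdL.mono Set.inter_subset_right Set.inter_subset_right)
          (Set.Subset.antisymm ((Set.inter_subset_inter (ends_mono Set.inter_subset_right)
            (ends_mono Set.inter_subset_right)).trans hi.subset) ?_)
        rintro x (rfl | rfl)
        exacts [⟨k₁.terminals_mem.1, k₂.terminals_mem.1⟩, ⟨k₁.terminals_mem.2, k₂.terminals_mem.2⟩]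
    have p₁ := piece h₁ ih₁ (hF ▸ Set.subset_union_left)
    have p₂ := piece h₂ ih₂ (hF ▸ Set.subset_union_right)
    exact ⟨join hn₁ (hF ▸ Set.subset_union_left) p₁.1 p₂.1,
      join hn₂ (hF ▸ Set.subset_union_right) p₁.2 p₂.2⟩

end SPEdges

/-- The subgraph formed by a set of edges and their ends. -/
def edgeSubgraph (G : Graph α β) (F : Set β) (hF : F ⊆ E(G)) : Graph α β where
  vertexSet := ends G F
  IsLink e x y := e ∈ F ∧ G.IsLink e x y
  edgeSet := F
  isLink_symm _ _ := ⟨fun _ _ h => ⟨h.1, h.2.symm⟩⟩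
  eq_or_eq_of_isLink_of_isLink _ _ _ _ _ h h' := h.2.left_eq_or_eq h'.2
  edge_mem_iff_exists_isLink e := by
    refine ⟨fun h => ?_, fun ⟨_, _, h, _⟩ => h⟩
    obtain ⟨x, y, hl⟩ := G.exists_isLink_of_mem_edgeSet (hF h)
    exact ⟨x, y, h, hl⟩
  left_mem_of_isLink _ _ _ h := ⟨_, h.1, h.2.inc_left⟩

theorem edgeSubgraph_le {F : Set β} (hF : F ⊆ E(G)) : edgeSubgraph G F hF ≤ G :=
  ⟨fun _ ⟨_, _, h⟩ => h.vertex_mem, fun _ _ _ h => h.2⟩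

end edgeSets

/-! ### From 2-terminal graphs to edge sets; prime series-parallel graphs are edges. -/

namespace TwoTerminal

variable {α β : Type*} {K K₁ K₂ : TwoTerminal α β}

/-- A 2-terminal series-parallel set of edges as a 2-terminal graph. -/
def ofSPEdges {G : Graph α β} {F : Set β} {s t : α} (h : SPEdges G F s t) : TwoTerminal α β where
  graph := edgeSubgraph G F h.subset
  s := s
  t := t
  s_mem := h.terminals_mem.1
  t_mem := h.terminals_mem.2
  s_ne_t := h.ne

theorem IsSP.spEdges (h : K.IsSP) : SPEdges K.graph E(K.graph) K.s K.t := by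
  induction h with
  | @edge K h =>
    obtain ⟨-, e, hE, hl⟩ := h
    rw [hE]
    exact .edge hl K.s_ne_t
  | @series K K₁ K₂ _ _ h ih₁ ih₂ =>
    have k₁ := ih₁.mono h.le_left
    have k₂ := ih₂.mono h.le_right
    rw [h.s_left] at k₁
    rw [← h.middle, h.t_right] at k₂
    rw [← h.union_edge]
    refine .series k₁ k₂ (Set.Subset.antisymm ?_
      (Set.singleton_subset_iff.2 ⟨k₁.terminals_mem.2, k₂.terminals_mem.1⟩))
    rw [← h.inter_vertex]
    exact Set.inter_subset_inter (ends_edgeSet_subset h.le_left) (ends_edgeSet_subset h.le_right)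
  | @parallel K K₁ K₂ _ _ h ih₁ ih₂ =>
    have k₁ := ih₁.mono h.le_left
    have k₂ := ih₂.mono h.le_right
    rw [h.s_left, h.t_left] at k₁
    rw [h.s_right, h.t_right] at k₂
    rw [← h.union_edge]
    refine .parallel k₁ k₂ h.disjoint_edge (Set.Subset.antisymm ?_ ?_)
    · rw [← h.inter_vertex]
      exact Set.inter_subset_inter (ends_edgeSet_subset h.le_left) (ends_edgeSet_subset h.le_right)
    · rintro x (rfl | rfl)
      exacts [⟨k₁.terminals_mem.1, k₂.terminals_mem.1⟩, ⟨k₁.terminals_mem.2, k₂.terminals_mem.2⟩]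

/-- The split is arbitrary, unrelated to the construction of `K`. Connectedness of the parts makes
their terminals ends of edges, as `SPEdges.of_series` requires. -/
theorem IsSeries.spEdges (h : K.IsSeries K₁ K₂) (c₁ : IsConnected K₁.graph)
    (c₂ : IsConnected K₂.graph) (hK : SPEdges K.graph E(K.graph) K.s K.t) :
    SPEdges K₁.graph E(K₁.graph) K₁.s K₁.t ∧ SPEdges K₂.graph E(K₂.graph) K₂.s K₂.t := by
  have hK₁ := ends_of_le h.le_left subset_rfl
  have hK₂ := ends_of_le h.le_right subset_rfl
  have t₁ := hK₁ ▸ c₁.mem_ends K₁.t_mem K₁.s_mem K₁.s_ne_t.symm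
  have s₂ := hK₂ ▸ c₂.mem_ends K₂.s_mem K₂.t_mem K₂.s_ne_t
  have := hK.of_series (m := K₁.t) h.union_edge.symm (Set.Subset.antisymm (by
      rw [← h.inter_vertex]
      exact Set.inter_subset_inter (ends_edgeSet_subset h.le_left) (ends_edgeSet_subset h.le_right))
      (Set.singleton_subset_iff.2 ⟨t₁, by rw [h.middle]; exact s₂⟩))
    (h.s_left ▸ hK₁ ▸ c₁.mem_ends K₁.s_mem K₁.t_mem K₁.s_ne_t)
    (h.t_right ▸ hK₂ ▸ c₂.mem_ends K₂.t_mem K₂.s_mem K₂.s_ne_t.symm)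
    (h.s_left ▸ K₁.s_ne_t.symm) (by rw [h.middle, ← h.t_right]; exact K₂.s_ne_t)
  rw [← h.s_left] at this
  nth_rw 2 [h.middle] at this
  rw [← h.t_right] at this
  exact ⟨this.1.anti h.le_left subset_rfl, this.2.anti h.le_right subset_rfl⟩

theorem IsParallel.spEdges (h : K.IsParallel K₁ K₂) (c₁ : IsConnected K₁.graph)
    (c₂ : IsConnected K₂.graph) (hK : SPEdges K.graph E(K.graph) K.s K.t) :
    SPEdges K₁.graph E(K₁.graph) K₁.s K₁.t ∧ SPEdges K₂.graph E(K₂.graph) K₂.s K₂.t := by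
  obtain ⟨e₁, he₁, -⟩ := c₁.mem_ends K₁.s_mem K₁.t_mem K₁.s_ne_t
  obtain ⟨e₂, he₂, -⟩ := c₂.mem_ends K₂.s_mem K₂.t_mem K₂.s_ne_t
  have := hK.of_parallel h.union_edge.symm h.disjoint_edge (by
      rw [← h.inter_vertex]
      exact Set.inter_subset_inter (ends_edgeSet_subset h.le_left) (ends_edgeSet_subset h.le_right))
    ⟨e₁, he₁⟩ ⟨e₂, he₂⟩
  rw [h.s_left, h.t_left, h.s_right, h.t_right]
  exact ⟨this.1.anti h.le_left subset_rfl, this.2.anti h.le_right subset_rfl⟩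

/-- If the last construction step were a composition, its two nonempty disjoint edge sets would span
strictly smaller 2-terminal graphs. They cover all vertices because `K` is connected. -/
theorem IsPrime.exists_edge (h : K.IsPrime) (hK : SPEdges K.graph E(K.graph) K.s K.t)
    (hc : IsConnected K.graph) :
    V(K.graph) = {K.s, K.t} ∧ ∃ e, E(K.graph) = {e} ∧ K.graph.IsLink e K.s K.t := by
  have hV : ends K.graph E(K.graph) = V(K.graph) := by
    refine (ends_edgeSet_subset le_rfl).antisymm fun x hx => ?_
    by_cases hs : x = K.s
    · exact hc.mem_ends hx K.t_mem (hs ▸ K.s_ne_t)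
    · exact hc.mem_ends hx K.s_mem hs
  generalize hF : E(K.graph) = F at hK hV
  generalize hs : K.s = s at hK
  generalize ht : K.t = t at hK
  have lt : ∀ F' F'' (hF' : F' ⊆ E(K.graph)), F' ∪ F'' = E(K.graph) → Disjoint F' F'' →
      F''.Nonempty → edgeSubgraph K.graph F' hF' < K.graph := by
    intro F' F'' hF' hU hd ⟨e, he⟩
    refine (edgeSubgraph_le hF').lt_of_ne fun heq => Set.disjoint_left.1 hd ?_ he
    have : E(edgeSubgraph K.graph F' hF') = E(K.graph) := by rw [heq]
    change F' = _ at this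
    rw [this, ← hU]
    exact .inr he
  cases hK with
  | @edge e _ _ hl hne =>
    refine ⟨?_, e, rfl, hl⟩
    rw [← hV]
    ext x
    constructor
    · rintro ⟨_, rfl, hx⟩
      exact hx.eq_or_eq_of_isLink hl
    · rintro (rfl | rfl)
      exacts [⟨e, rfl, hl.inc_left⟩, ⟨e, rfl, hl.inc_right⟩]
  | @series F₁ F₂ _ m _ h₁ h₂ hi =>
    have hd := (SPEdges.series h₁ h₂ hi).disjoint_of_ends Set.subset_union_left hi.subset
    refine absurd ?_ (h (ofSPEdges h₁) (ofSPEdges h₂) (lt _ _ h₁.subset hF.symm hd h₂.nonempty)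
      (lt _ _ h₂.subset ((Set.union_comm _ _).trans hF.symm) hd.symm h₁.nonempty)).2
    exact ⟨edgeSubgraph_le h₁.subset, edgeSubgraph_le h₂.subset, (ends_union _ _).symm.trans hV, hF.symm, hd, hi,
      hs.symm, rfl, ht.symm⟩
  | @parallel F₁ F₂ _ _ h₁ h₂ hd hi =>
    refine absurd ?_ (h (ofSPEdges h₁) (ofSPEdges h₂) (lt _ _ h₁.subset hF.symm hd h₂.nonempty)
      (lt _ _ h₂.subset ((Set.union_comm _ _).trans hF.symm) hd.symm h₁.nonempty)).1
    exact ⟨edgeSubgraph_le h₁.subset, edgeSubgraph_le h₂.subset, (ends_union _ _).symm.trans hV, hF.symm, hd,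
      by rw [hs, ht]; exact hi, hs.symm, hs.symm, ht.symm, ht.symm⟩

end TwoTerminal

/-! ### Induction along a maximal decomposition tree. -/

namespace DecompTree

variable {α β : Type*}

theorem isConnected {K : TwoTerminal α β} (T : DecompTree K) : IsConnected K.graph := by
  cases T <;> assumption

theorem edgeSet_subset {K : TwoTerminal α β} (T : DecompTree K) :
    ∀ H ∈ T.nodes, E(H.graph) ⊆ E(K.graph) := by
  induction T with
  | leaf => exact fun H hH => (congrArg (fun H => E(H.graph)) hH).subset
  | snode _ h _ _ ih₁ ih₂ =>
    rintro H (hH | hH | hH)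
    exacts [(congrArg (fun H => E(H.graph)) hH).subset, (ih₁ H hH).trans h.le_left.edgeSet_mono,
      (ih₂ H hH).trans h.le_right.edgeSet_mono]
  | pnode _ h _ _ ih₁ ih₂ =>
    rintro H (hH | hH | hH)
    exacts [(congrArg (fun H => E(H.graph)) hH).subset, (ih₁ H hH).trans h.le_left.edgeSet_mono,
      (ih₂ H hH).trans h.le_right.edgeSet_mono]

theorem self_mem_nodes {K : TwoTerminal α β} (T : DecompTree K) : K ∈ T.nodes := by
  cases T
  exacts [rfl, .inl rfl, .inl rfl]

theorem edgeSet_nonempty {K : TwoTerminal α β} (T : DecompTree K) : E(K.graph).Nonempty :=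
  let ⟨e, he, _⟩ := T.isConnected.mem_ends K.s_mem K.t_mem K.s_ne_t
  ⟨e, he⟩

/-- A node below one child lacks the edges of the sibling, which has at least one. Hence all nodes
below the root are proper, and the flow bound applies to them. -/
theorem ne_of_mem_nodes {K K₁ K₂ : TwoTerminal α β} (T₁ : DecompTree K₁) (T₂ : DecompTree K₂)
    (hE : E(K₁.graph) ∪ E(K₂.graph) = E(K.graph)) (hd : Disjoint E(K₁.graph) E(K₂.graph))
    {H : TwoTerminal α β} (hH : H ∈ T₁.nodes) : H ≠ K := by
  rintro rfl
  obtain ⟨e, he⟩ := T₂.edgeSet_nonempty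
  exact Set.disjoint_left.1 hd (T₁.edgeSet_subset H hH (hE.subset (.inr he))) he

/-- In a maximal decomposition tree of a series-parallel graph, all vertex sets are finite and the
between-terminals flows are positive. -/
theorem finite_and_flow_pos {K : TwoTerminal α β} (T : DecompTree K) (hT : T.IsMaximal)
    (hK : SPEdges K.graph E(K.graph) K.s K.t) : V(K.graph).Finite ∧ 1 ≤ K.terminalFlow := by
  induction T with
  | @leaf K hc =>
    obtain ⟨hV, e, hE, hl⟩ := (hT K rfl).exists_edge hK hc
    exact ⟨hV ▸ Set.toFinite _, (TwoTerminal.terminalFlow_of_edge hE hl).ge⟩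
  | @snode K K₁ K₂ hc h T₁ T₂ ih₁ ih₂ =>
    have hS := h.spEdges T₁.isConnected T₂.isConnected hK
    obtain ⟨f₁, p₁⟩ := ih₁ (fun L hL => hT L (.inl hL)) hS.1
    obtain ⟨f₂, p₂⟩ := ih₂ (fun L hL => hT L (.inr hL)) hS.2
    exact ⟨h.union_vertex ▸ f₁.union f₂, (h.terminalFlow_eq hK.finite).symm ▸ le_min p₁ p₂⟩
  | @pnode K K₁ K₂ hc h T₁ T₂ ih₁ ih₂ =>
    have hS := h.spEdges T₁.isConnected T₂.isConnected hK
    obtain ⟨f₁, p₁⟩ := ih₁ (fun L hL => hT L (.inl hL)) hS.1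
    obtain ⟨f₂, p₂⟩ := ih₂ (fun L hL => hT L (.inr hL)) hS.2
    exact ⟨h.union_vertex ▸ f₁.union f₂,
      (h.terminalFlow_eq hK.finite).symm ▸ p₁.trans (Nat.le_add_right _ _)⟩

theorem effWeight_mem {q : ℂ} (hq : q ≠ 0) {n : ℕ} {S : ℕ → Set ℂ}
    (h_ser : ∀ k l, 1 ≤ k → k ≤ n → 1 ≤ l → l ≤ n →
      Set.image2 (ser q) (S k) (S l) ⊆ some '' S (min k l))
    (h_par : ∀ k l, 1 ≤ k → 1 ≤ l → k + l ≤ n → Set.image2 par (S k) (S l) ⊆ S (k + l))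
    {K : TwoTerminal α β} (T : DecompTree K) (hT : T.IsMaximal)
    (hK : SPEdges K.graph E(K.graph) K.s K.t)
    (hflow : ∀ H ∈ T.nodes, H ≠ K → H.terminalFlow ≤ n) (v : β → ℂ)
    (hv : ∀ e ∈ E(K.graph), v e ∈ S 1) :
    ∀ H ∈ T.nodes, H.terminalFlow ≤ n → H.effWeight q v ∈ some '' S H.terminalFlow := by
  induction T with
  | @leaf K hc =>
    intro H hH _
    obtain ⟨hV, e, hE, hl⟩ := (hT K rfl).exists_edge hK hc
    rw [show H = K from hH, TwoTerminal.terminalFlow_of_edge hE hl, TwoTerminal.effWeight_of_edge hV hE hl hq]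
    exact ⟨v e, hv e (hE ▸ rfl), rfl⟩
  | @snode K K₁ K₂ hc h T₁ T₂ ih₁ ih₂ =>
    have hS := h.spEdges T₁.isConnected T₂.isConnected hK
    have m₁ : T₁.IsMaximal := fun L hL => hT L (.inl hL)
    have m₂ : T₂.IsMaximal := fun L hL => hT L (.inr hL)
    have fl₁ : ∀ H ∈ T₁.nodes, H.terminalFlow ≤ n := fun H hH => hflow H (.inr (.inl hH))
      (ne_of_mem_nodes T₁ T₂ h.union_edge h.disjoint_edge hH)
    have fl₂ : ∀ H ∈ T₂.nodes, H.terminalFlow ≤ n := fun H hH => hflow H (.inr (.inr hH))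
      (ne_of_mem_nodes T₂ T₁ ((Set.union_comm _ _).trans h.union_edge) h.disjoint_edge.symm hH)
    have ih₁ := ih₁ m₁ hS.1 (fun H hH _ => fl₁ H hH) fun e he => hv e (h.le_left.edgeSet_mono he)
    have ih₂ := ih₂ m₂ hS.2 (fun H hH _ => fl₂ H hH) fun e he => hv e (h.le_right.edgeSet_mono he)
    rintro H (hH | hH | hH) hle
    · rw [hH] at hle ⊢
      have s₁ := T₁.self_mem_nodes
      have s₂ := T₂.self_mem_nodes
      obtain ⟨a, ha, ea⟩ := ih₁ _ s₁ (fl₁ _ s₁)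
      obtain ⟨b, hb, eb⟩ := ih₂ _ s₂ (fl₂ _ s₂)
      obtain ⟨f₁, p₁⟩ := T₁.finite_and_flow_pos m₁ hS.1
      obtain ⟨f₂, p₂⟩ := T₂.finite_and_flow_pos m₂ hS.2
      -- Inclusion in the image of `some` includes that the series operation is defined.
      obtain ⟨w, hw, ew⟩ := h_ser _ _ p₁ (fl₁ _ s₁) p₂ (fl₂ _ s₂) ⟨a, ha, b, hb, rfl⟩
      rw [h.terminalFlow_eq hK.finite, h.effWeight_eq (h.union_vertex ▸ f₁.union f₂) hK.finite hq
        ea.symm eb.symm ew.symm]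
      exact ⟨w, hw, rfl⟩
    · exact ih₁ H hH hle
    · exact ih₂ H hH hle
  | @pnode K K₁ K₂ hc h T₁ T₂ ih₁ ih₂ =>
    have hS := h.spEdges T₁.isConnected T₂.isConnected hK
    have m₁ : T₁.IsMaximal := fun L hL => hT L (.inl hL)
    have m₂ : T₂.IsMaximal := fun L hL => hT L (.inr hL)
    have fl₁ : ∀ H ∈ T₁.nodes, H.terminalFlow ≤ n := fun H hH => hflow H (.inr (.inl hH))
      (ne_of_mem_nodes T₁ T₂ h.union_edge h.disjoint_edge hH)
    have fl₂ : ∀ H ∈ T₂.nodes, H.terminalFlow ≤ n := fun H hH => hflow H (.inr (.inr hH))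
      (ne_of_mem_nodes T₂ T₁ ((Set.union_comm _ _).trans h.union_edge) h.disjoint_edge.symm hH)
    have ih₁ := ih₁ m₁ hS.1 (fun H hH _ => fl₁ H hH) fun e he => hv e (h.le_left.edgeSet_mono he)
    have ih₂ := ih₂ m₂ hS.2 (fun H hH _ => fl₂ H hH) fun e he => hv e (h.le_right.edgeSet_mono he)
    rintro H (hH | hH | hH) hle
    · rw [hH] at hle ⊢
      have s₁ := T₁.self_mem_nodes
      have s₂ := T₂.self_mem_nodes
      obtain ⟨a, ha, ea⟩ := ih₁ _ s₁ (fl₁ _ s₁)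
      obtain ⟨b, hb, eb⟩ := ih₂ _ s₂ (fl₂ _ s₂)
      obtain ⟨f₁, p₁⟩ := T₁.finite_and_flow_pos m₁ hS.1
      obtain ⟨f₂, p₂⟩ := T₂.finite_and_flow_pos m₂ hS.2
      rw [h.terminalFlow_eq hK.finite] at hle ⊢
      rw [h.effWeight_eq (h.union_vertex ▸ f₁.union f₂) hK.finite hq ea.symm eb.symm]
      exact ⟨_, h_par _ _ p₁ p₂ hle ⟨a, ha, b, hb, rfl⟩, rfl⟩
    · exact ih₁ H hH hle
    · exact ih₂ H hH hle

end DecompTree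

/-! ### The multivariate Tutte polynomial under extensions and on forests. -/

section sums

variable {α β : Type*} {G G' : Graph α β}

theorem tutte_eq_sum {R : Type*} [CommRing R] (hE : E(G).Finite) (q : R) (v : β → R) :
    tutte G q v = ∑ A ∈ hE.toFinset.powerset, q ^ numComponents G A * ∏ e ∈ A, v e := by
  have : {A : Finset β | (A : Set β) ⊆ E(G)} = (hE.toFinset.powerset : Set (Finset β)) := by
    ext A
    simp
  rw [tutte, this, finsum_mem_coe_finset]

theorem eval_chromaticPolynomial (hE : E(G).Finite) (q : ℂ) :
    (chromaticPolynomial G).eval q = tutte G q fun _ => -1 := by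
  rw [chromaticPolynomial, tutte_eq_sum hE, tutte_eq_sum hE, Polynomial.eval_finsetSum]
  simp

theorem tutte_update_eq_sum [DecidableEq β] (hE : E(G).Finite) {e : β} (he : e ∈ E(G)) (q : ℂ)
    (v : β → ℂ) (z : ℂ) {F : Finset β} (hF : (F : Set β) = E(G) \ {e}) :
    tutte G q (Function.update v e z) = ∑ A ∈ F.powerset,
      (∏ f ∈ A, v f) * (q ^ numComponents G A + z * q ^ numComponents G (insert e (A : Set β))) := by
  have heF : e ∉ F := fun h => (hF.subset h).2 rfl
  have : hE.toFinset = insert e F := by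
    rw [← Finset.coe_inj, Finset.coe_insert, hF, Set.Finite.coe_toFinset,
      Set.insert_sdiff_singleton, Set.insert_eq_of_mem he]
  rw [tutte_eq_sum hE, this, Finset.sum_powerset_insert heF, ← Finset.sum_add_distrib]
  refine Finset.sum_congr rfl fun A hA => ?_
  have heA : e ∉ A := fun h => heF (Finset.mem_powerset.1 hA h)
  rw [Finset.prod_insert heA, Finset.prod_update_of_notMem heA, Function.update_self,
    Finset.coe_insert]
  ring

theorem tutte_eq_sum_insert_insert [DecidableEq β] (hE : E(G).Finite) {f₁ f₂ : β} (hne : f₁ ≠ f₂)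
    (q : ℂ) (v : β → ℂ) {F : Finset β} (h₁ : f₁ ∉ F) (h₂ : f₂ ∉ F)
    (hF : E(G) = insert f₁ (insert f₂ (F : Set β))) :
    tutte G q v = ∑ A ∈ F.powerset, (∏ f ∈ A, v f) *
      (q ^ numComponents G A + v f₁ * q ^ numComponents G (insert f₁ (A : Set β)) +
        v f₂ * q ^ numComponents G (insert f₂ (A : Set β)) +
        v f₁ * v f₂ * q ^ numComponents G (insert f₂ (insert f₁ (A : Set β)))) := by
  have : hE.toFinset = insert f₁ (insert f₂ F) := by
    rw [← Finset.coe_inj, Set.Finite.coe_toFinset, hF, Finset.coe_insert, Finset.coe_insert]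
  have h₁' : f₁ ∉ insert f₂ F := by simp [hne, h₁]
  rw [tutte_eq_sum hE, this, Finset.sum_powerset_insert h₁', Finset.sum_powerset_insert h₂,
    Finset.sum_powerset_insert h₂, ← Finset.sum_add_distrib, ← Finset.sum_add_distrib,
    ← Finset.sum_add_distrib]
  refine Finset.sum_congr rfl fun A hA => ?_
  have h₁A : f₁ ∉ A := fun h => h₁ (Finset.mem_powerset.1 hA h)
  have h₂A : f₂ ∉ A := fun h => h₂ (Finset.mem_powerset.1 hA h)
  have h₁A' : f₁ ∉ insert f₂ A := by simp [hne, h₁A]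
  rw [Finset.prod_insert h₁A', Finset.prod_insert h₂A, Finset.prod_insert h₁A, Finset.coe_insert,
    Finset.coe_insert, Finset.coe_insert, Finset.coe_insert,
    Set.insert_comm f₁ f₂]
  ring

theorem linked_congr {A : Set β} (h : ∀ f ∈ A, ∀ a b, G'.IsLink f a b ↔ G.IsLink f a b) :
    linked G' A = linked G A := by
  ext a b
  exact exists_congr fun f => and_congr_right fun hf => h f hf a b

/-- The data of a series extension, with the edges `e`, `f₁`, `f₂` and the ends `x`, `w`, `y`. -/
structure SeriesExt (G G' : Graph α β) (e f₁ f₂ : β) (x y w : α) : Prop where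
  link : G.IsLink e x y
  w_notMem : w ∉ V(G)
  ne : f₁ ≠ f₂
  notMem₁ : f₁ ∉ E(G) \ {e}
  notMem₂ : f₂ ∉ E(G) \ {e}
  vertexSet_eq : V(G') = insert w V(G)
  isLink_iff : ∀ f a b, G'.IsLink f a b ↔
    (f ≠ e ∧ G.IsLink f a b) ∨ (f = f₁ ∧ s(a, b) = s(x, w)) ∨ (f = f₂ ∧ s(a, b) = s(w, y))

/-- The data of a parallel extension, with the edges `e`, `f₁`, `f₂` and the ends `x`, `y`. -/
structure ParallelExt (G G' : Graph α β) (e f₁ f₂ : β) (x y : α) : Prop where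
  link : G.IsLink e x y
  ne : f₁ ≠ f₂
  notMem₁ : f₁ ∉ E(G) \ {e}
  notMem₂ : f₂ ∉ E(G) \ {e}
  vertexSet_eq : V(G') = V(G)
  isLink_iff : ∀ f a b, G'.IsLink f a b ↔
    (f ≠ e ∧ G.IsLink f a b) ∨ (f = f₁ ∧ s(a, b) = s(x, y)) ∨ (f = f₂ ∧ s(a, b) = s(x, y))

variable {e f₁ f₂ : β} {x y w : α}

theorem edgeSet_eq_insert_insert {p₁ p₂ : Sym2 α}
    (h : ∀ f a b, G'.IsLink f a b ↔
      (f ≠ e ∧ G.IsLink f a b) ∨ (f = f₁ ∧ s(a, b) = p₁) ∨ (f = f₂ ∧ s(a, b) = p₂)) :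
    E(G') = insert f₁ (insert f₂ (E(G) \ {e})) := by
  ext f
  constructor
  · intro hf
    obtain ⟨a, b, hl⟩ := G'.exists_isLink_of_mem_edgeSet hf
    rcases (h f a b).1 hl with ⟨h1, h2⟩ | ⟨rfl, -⟩ | ⟨rfl, -⟩
    exacts [.inr (.inr ⟨h2.edge_mem, h1⟩), .inl rfl, .inr (.inl rfl)]
  · rintro (rfl | rfl | ⟨hf, hfe⟩)
    · induction p₁ with | h a b => exact ((h f a b).2 (.inr (.inl ⟨rfl, rfl⟩))).edge_mem
    · induction p₂ with | h a b => exact ((h f a b).2 (.inr (.inr ⟨rfl, rfl⟩))).edge_mem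
    · obtain ⟨a, b, hl⟩ := G.exists_isLink_of_mem_edgeSet hf
      exact ((h f a b).2 (.inl ⟨hfe, hl⟩)).edge_mem

theorem isLink_iff_of_mem {p₁ p₂ : Sym2 α} (h₁ : f₁ ∉ E(G) \ {e}) (h₂ : f₂ ∉ E(G) \ {e})
    (h : ∀ f a b, G'.IsLink f a b ↔
      (f ≠ e ∧ G.IsLink f a b) ∨ (f = f₁ ∧ s(a, b) = p₁) ∨ (f = f₂ ∧ s(a, b) = p₂)) :
    ∀ f ∈ E(G) \ {e}, ∀ a b, G'.IsLink f a b ↔ G.IsLink f a b := by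
  intro f hf a b
  rw [h]
  have n₁ : f ≠ f₁ := fun h => h₁ (h ▸ hf)
  have n₂ : f ≠ f₂ := fun h => h₂ (h ▸ hf)
  have n : f ≠ e := hf.2
  simp [n₁, n₂, n]

namespace SeriesExt

theorem symm (h : SeriesExt G G' e f₁ f₂ x y w) : SeriesExt G G' e f₂ f₁ y x w where
  link := h.link.symm
  w_notMem := h.w_notMem
  ne := h.ne.symm
  notMem₁ := h.notMem₂
  notMem₂ := h.notMem₁
  vertexSet_eq := h.vertexSet_eq
  isLink_iff f a b := by
    rw [h.isLink_iff, Sym2.eq_swap (a := y), Sym2.eq_swap (a := w) (b := x)]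
    tauto

theorem link₁ (h : SeriesExt G G' e f₁ f₂ x y w) : G'.IsLink f₁ x w :=
  (h.isLink_iff _ _ _).2 (.inr (.inl ⟨rfl, rfl⟩))

theorem link₂ (h : SeriesExt G G' e f₁ f₂ x y w) : G'.IsLink f₂ w y :=
  (h.isLink_iff _ _ _).2 (.inr (.inr ⟨rfl, rfl⟩))

/-- For fixed `A` there are four choices of new edges: with neither, `w` is an extra component; with
one, `w` hangs on as a pendant vertex; with both, the path acts like `e`. -/
theorem tutte_eq [DecidableEq β] (h : SeriesExt G G' e f₁ f₂ x y w) (hV : V(G).Finite)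
    (hE : E(G').Finite) (q : ℂ) (v : β → ℂ) {F : Finset β} (hF : (F : Set β) = E(G) \ {e}) :
    tutte G' q v = ∑ A ∈ F.powerset, (∏ f ∈ A, v f) *
      ((q + v f₁ + v f₂) * q ^ numComponents G A +
        v f₁ * v f₂ * q ^ numComponents G (insert e (A : Set β))) := by
  rw [tutte_eq_sum_insert_insert hE h.ne q v (F := F)
    (fun h' => h.notMem₁ (hF ▸ h')) (fun h' => h.notMem₂ (hF ▸ h'))
    (hF.symm ▸ edgeSet_eq_insert_insert h.isLink_iff)]
  refine Finset.sum_congr rfl fun A hA => ?_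
  have hA : (A : Set β) ⊆ E(G) \ {e} := hF ▸ Finset.coe_subset.2 (Finset.mem_powerset.1 hA)
  have hV' : V(G').Finite := h.vertexSet_eq ▸ hV.insert w
  have hl : linked G' A = linked G A := linked_congr fun f hf =>
    isLink_iff_of_mem h.notMem₁ h.notMem₂ h.isLink_iff f (hA hf)
  have hc : ∀ a b, Conn G' A a b ↔ Conn G A a b := fun a b => by rw [conn_def, hl, conn_def]
  have hw : ∀ a ∈ V(G), ¬ Conn G' A a w ∧ ¬ Conn G' A w a := by
    intro a ha
    have hne : a ≠ w := fun h' => h.w_notMem (h' ▸ ha)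
    rw [hc, hc]
    exact ⟨fun h' => hne (eq_of_reflTransGen_of_notMem (linked_mem _) h' (.inr h.w_notMem)),
      fun h' => hne (eq_of_reflTransGen_of_notMem (linked_mem _) h' (.inl h.w_notMem)).symm⟩
  have k0 : numComponents G' A = numComponents G A + 1 := by
    rw [numComponents_eq, hl, h.vertexSet_eq, comps_insert hV (linked_mem _) h.w_notMem,
      numComponents_eq]
  have k1 := numComponents_insert_of_not_conn hV' h.link₁ (hw x h.link.left_mem).1
  have k2 := numComponents_insert_of_not_conn hV' h.link₂ (hw y h.link.right_mem).2
  have k3 : numComponents G' (insert f₂ (insert f₁ (A : Set β))) =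
      numComponents G (insert e (A : Set β)) := by
    by_cases hxy : Conn G A x y
    · have : Conn G' (insert f₁ (A : Set β)) w y :=
        .head ⟨f₁, .inl rfl, h.link₁.symm⟩ (((hc x y).2 hxy).mono (Set.subset_insert _ _))
      rw [numComponents_insert_of_conn h.link₂ this, numComponents_insert_of_conn h.link hxy]
      omega
    · have : ¬ Conn G' (insert f₁ (A : Set β)) w y := by
        rw [conn_def, linked_insert h.link₁, reflTransGen_addLink_iff]
        rintro (h' | h' | h')
        · exact (hw y h.link.right_mem).2 h'
        · exact (hw x h.link.left_mem).2 h'.1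
        · exact hxy ((hc x y).1 h'.2)
      have := numComponents_insert_of_not_conn hV' h.link₂ this
      have := numComponents_insert_of_not_conn hV h.link hxy
      omega
  have k1' : numComponents G' (insert f₁ (A : Set β)) = numComponents G A := by omega
  have k2' : numComponents G' (insert f₂ (A : Set β)) = numComponents G A := by omega
  rw [k0, k1', k2', k3]
  ring

theorem tutte_eq_mul (h : SeriesExt G G' e f₁ f₂ x y w) [DecidableEq β] (hV : V(G).Finite)
    (hE : E(G).Finite) (hE' : E(G').Finite) (q : ℂ) (v : β → ℂ) (h0 : q + v f₁ + v f₂ ≠ 0) :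
    tutte G' q v = (q + v f₁ + v f₂) *
      tutte G q (Function.update v e (v f₁ * v f₂ / (q + v f₁ + v f₂))) := by
  have hF : (((hE.subset Set.sdiff_subset).toFinset : Finset β) : Set β) = E(G) \ {e} :=
    Set.Finite.coe_toFinset _
  rw [h.tutte_eq hV hE' q v hF, tutte_update_eq_sum hE h.link.edge_mem q v _ hF, Finset.mul_sum]
  refine Finset.sum_congr rfl fun A _ => ?_
  field_simp

/-- When `e` is a bridge, adding it always loses one component, and `(q + v f₁ + v f₂) * q + v f₁ *
v f₂ = (q + v f₁) * (q + v f₂)`. No denominator appears, so `ser` need not be defined. -/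
theorem tutte_eq_mul_of_not_conn (h : SeriesExt G G' e f₁ f₂ x y w) [DecidableEq β]
    (hV : V(G).Finite) (hE : E(G).Finite) (hE' : E(G').Finite) (q : ℂ) (v : β → ℂ)
    (h0 : ¬ Conn G (E(G) \ {e}) x y) :
    tutte G' q v = (q + v f₁) * tutte G q (Function.update v e (v f₂)) := by
  have hF : (((hE.subset Set.sdiff_subset).toFinset : Finset β) : Set β) = E(G) \ {e} :=
    Set.Finite.coe_toFinset _
  rw [h.tutte_eq hV hE' q v hF, tutte_update_eq_sum hE h.link.edge_mem q v _ hF, Finset.mul_sum]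
  refine Finset.sum_congr rfl fun A hA => ?_
  have hA : (A : Set β) ⊆ E(G) \ {e} := hF ▸ Finset.coe_subset.2 (Finset.mem_powerset.1 hA)
  rw [← numComponents_insert_of_not_conn hV h.link fun h' => h0 (h'.mono hA)]
  ring

end SeriesExt

namespace ParallelExt

theorem link₁ (h : ParallelExt G G' e f₁ f₂ x y) : G'.IsLink f₁ x y :=
  (h.isLink_iff _ _ _).2 (.inr (.inl ⟨rfl, rfl⟩))

theorem link₂ (h : ParallelExt G G' e f₁ f₂ x y) : G'.IsLink f₂ x y :=
  (h.isLink_iff _ _ _).2 (.inr (.inr ⟨rfl, rfl⟩))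

theorem tutte_eq [DecidableEq β] (h : ParallelExt G G' e f₁ f₂ x y) (hE : E(G).Finite)
    (hE' : E(G').Finite) (q : ℂ) (v : β → ℂ) :
    tutte G' q v = tutte G q (Function.update v e (par (v f₁) (v f₂))) := by
  have hF : (((hE.subset Set.sdiff_subset).toFinset : Finset β) : Set β) = E(G) \ {e} :=
    Set.Finite.coe_toFinset _
  rw [tutte_update_eq_sum hE h.link.edge_mem q v _ hF, tutte_eq_sum_insert_insert hE' h.ne q v
    (fun h' => h.notMem₁ (hF ▸ h')) (fun h' => h.notMem₂ (hF ▸ h'))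
    (hF.symm ▸ edgeSet_eq_insert_insert h.isLink_iff)]
  refine Finset.sum_congr rfl fun A hA => ?_
  have hA : (A : Set β) ⊆ E(G) \ {e} := hF ▸ Finset.coe_subset.2 (Finset.mem_powerset.1 hA)
  have hl : linked G' A = linked G A := linked_congr fun f hf =>
    isLink_iff_of_mem h.notMem₁ h.notMem₂ h.isLink_iff f (hA hf)
  have k0 : numComponents G' A = numComponents G A := by
    rw [numComponents_eq, hl, h.vertexSet_eq, numComponents_eq]
  have k1 : ∀ {f}, G'.IsLink f x y →
      numComponents G' (insert f (A : Set β)) = numComponents G (insert e (A : Set β)) := by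
    intro f hf
    rw [numComponents_eq, linked_insert hf, hl, h.vertexSet_eq, ← linked_insert h.link,
      numComponents_eq]
  have hc : Conn G' (insert f₁ (A : Set β)) x y := .single ⟨f₁, .inl rfl, h.link₁⟩
  rw [numComponents_insert_of_conn h.link₂ hc, k0, k1 h.link₁,
    k1 h.link₂]
  unfold par
  ring

end ParallelExt

theorem IsForest.not_conn (hG : IsForest G) {e : β} {x y : α} (hl : G.IsLink e x y)
    {A : Set β} (he : e ∉ A) : ¬ Conn G A x y := by
  have := hG.1
  intro h
  have hb := SimpleGraph.isAcyclic_iff_forall_adj_isBridge.1 hG.2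
    (v := ⟨x, hl.left_mem⟩) (w := ⟨y, hl.right_mem⟩)
    ((Graph.toSimpleGraph_adj_iff _ _).2 hl.adj)
  rw [SimpleGraph.isBridge_iff] at hb
  have key : ∀ z, Conn G A x z → ∀ hz : z ∈ V(G),
      (G.toSimpleGraph.deleteEdges {s(⟨x, hl.left_mem⟩, ⟨y, hl.right_mem⟩)}).Reachable
        ⟨x, hl.left_mem⟩ ⟨z, hz⟩ := by
    intro z hz
    induction hz with
    | refl => exact fun _ => .refl _
    | @tail b c _ hbc ih =>
      obtain ⟨f, hf, hfl⟩ := hbc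
      intro hc
      refine (ih hfl.left_mem).trans (SimpleGraph.Adj.reachable ?_)
      rw [SimpleGraph.deleteEdges_adj]
      refine ⟨(Graph.toSimpleGraph_adj_iff _ _).2 hfl.adj, fun heq => he ?_⟩
      have : e = f := by
        simp only [Set.mem_singleton_iff, Sym2.eq_iff, Subtype.mk.injEq] at heq
        rcases heq with ⟨rfl, rfl⟩ | ⟨rfl, rfl⟩
        exacts [hl.eq hfl, hl.eq hfl.symm]
      exact this ▸ hf
  exact hb (key y h hl.right_mem)

/-- Every edge of a forest is a bridge, so each new edge multiplies the sum by `1 + v e / q`. -/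
theorem IsForest.tutte_ne_zero (hG : IsForest G) (hV : V(G).Finite) (hE : E(G).Finite) {q : ℂ}
    (hq : q ≠ 0) {v : β → ℂ} (hv : ∀ e ∈ E(G), v e ≠ -q) : tutte G q v ≠ 0 := by
  classical
  rw [tutte_eq_sum hE]
  have key : ∀ F : Finset β, (F : Set β) ⊆ E(G) →
      ∑ A ∈ F.powerset, q ^ numComponents G A * ∏ e ∈ A, v e ≠ 0 := by
    intro F
    induction F using Finset.induction_on with
    | empty => simp [hq]
    | @insert e F he ih =>
      intro hF
      rw [Finset.coe_insert, Set.insert_subset_iff] at hF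
      obtain ⟨x, y, hl⟩ := G.exists_isLink_of_mem_edgeSet hF.1
      have h1 : 1 + v e / q ≠ 0 := by
        intro h
        field_simp at h
        exact hv e hF.1 (by linear_combination h)
      rw [Finset.sum_powerset_insert he, ← Finset.sum_add_distrib]
      convert mul_ne_zero h1 (ih hF.2) using 1
      rw [Finset.mul_sum]
      refine Finset.sum_congr rfl fun A hA => ?_
      have heA : e ∉ A := fun h => he (Finset.mem_powerset.1 hA h)
      rw [Finset.prod_insert heA, Finset.coe_insert,
        ← numComponents_insert_of_not_conn hV hl (hG.not_conn hl (Finset.mem_coe.not.2 heA))]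
      field_simp
      ring
  exact key _ (by simp)

end sums

/-! ### Edges with capacities and the reduction to a forest. -/

section capacities

variable {α β : Type*} {G G' : Graph α β}

/-- Any two distinct vertices are separated by a set of edges of total capacity at most `n`. -/
def CutsLE (G : Graph α β) (c : β → ℕ) (n : ℕ) : Prop :=
  ∀ a ∈ V(G), ∀ b ∈ V(G), a ≠ b →
    ∃ C : Finset β, (C : Set β) ⊆ E(G) ∧ ∑ e ∈ C, c e ≤ n ∧ ¬ Conn G (E(G) \ C) a b

theorem cutsLE_of_maxmaxflow_le (hV : V(G).Finite) (hE : E(G).Finite) {n : ℕ}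
    (h : maxmaxflow G ≤ n) : CutsLE G (fun _ => 1) n := by
  intro a ha b hb hab
  obtain ⟨C, hC, hc, hn⟩ := exists_card_eq_flow hE hab
  refine ⟨C, hC, ?_, hn⟩
  rw [Finset.sum_const, smul_eq_mul, mul_one, hc]
  -- Boundedness is needed because the supremum of an unbounded set of naturals is `0` by default.
  have hbdd : BddAbove {n | ∃ x ∈ V(G), ∃ y ∈ V(G), x ≠ y ∧ n = flow G x y} := by
    refine Set.Finite.bddAbove (((hV.prod hV).image fun p => flow G p.1 p.2).subset ?_)
    rintro _ ⟨x, hx, y, hy, -, rfl⟩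
    exact ⟨(x, y), ⟨hx, hy⟩, rfl⟩
  exact (le_csSup hbdd ⟨a, ha, b, hb, hab, rfl⟩).trans h

theorem mem_cut {e : β} {x y : α} (hl : G.IsLink e x y) {C : Finset β}
    (h : ¬ Conn G (E(G) \ C) x y) : e ∈ C := by
  by_contra he
  exact h (.single ⟨e, ⟨hl.edge_mem, he⟩, hl⟩)

/-- Cuts in a graph `G'`, obtained from `G` by replacing `e` by `f₁` and `f₂`, give cuts in `G`,
if the cuts that separate the ends of `e` in the new part are sufficiently large. -/
theorem CutsLE.of_replace [DecidableEq β] {e f₁ f₂ : β} {x y : α} {c : β → ℕ} {n k : ℕ}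
    (h : CutsLE G' c n) (hl : G.IsLink e x y) (hV : V(G) ⊆ V(G'))
    (hE : E(G') = insert f₁ (insert f₂ (E(G) \ {e})))
    (hlink : ∀ f ∈ E(G) \ {e}, ∀ a b, G'.IsLink f a b ↔ G.IsLink f a b)
    (h₁ : f₁ ∉ E(G) \ {e}) (h₂ : f₂ ∉ E(G) \ {e})
    (hcut : ∀ C : Finset β, Conn G' (E(G') \ C) x y ∨
      k + ∑ f ∈ (C.erase f₁).erase f₂, c f ≤ ∑ f ∈ C, c f) :
    CutsLE G (Function.update c e k) n := by
  intro a ha b hb hab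
  obtain ⟨C, hC, hc, hn⟩ := h a (hV ha) b (hV hb) hab
  set D := (C.erase f₁).erase f₂ with hD
  have hDE : (D : Set β) ⊆ E(G) \ {e} := by
    intro f hf
    have hf : f ≠ f₂ ∧ f ≠ f₁ ∧ f ∈ C := by simpa only [hD, Finset.mem_coe, Finset.mem_erase] using hf
    exact ((hE ▸ hC hf.2.2 : f ∈ insert f₁ (insert f₂ (E(G) \ {e}))).resolve_left
      hf.2.1).resolve_left hf.1
  have heD : e ∉ D := fun h => (hDE h).2 rfl
  have step : ∀ f ∈ E(G) \ {e}, f ∉ D → f ∈ E(G') \ C := by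
    intro f hf hfD
    refine ⟨hE ▸ .inr (.inr hf), fun hfC => hfD ?_⟩
    have n₁ : f ≠ f₁ := fun h => h₁ (h ▸ hf)
    have n₂ : f ≠ f₂ := fun h => h₂ (h ▸ hf)
    simpa [hD, n₁, n₂] using hfC
  -- If `G' - C` still joins `x` to `y`, any use of `e` can be rerouted there, so the old part `D`
  -- already cuts `G`. In the other case the new edges in `C` have total capacity at least `k`,
  -- which pays for putting `e` into the cut.
  rcases hcut C with hxy | hle
  · refine ⟨D, hDE.trans Set.sdiff_subset, ?_, fun hab' => hn ?_⟩
    · rw [Finset.sum_update_of_notMem heD]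
      exact (Finset.sum_le_sum_of_subset ((Finset.erase_subset _ _).trans
        (Finset.erase_subset _ _))).trans hc
    · clear hb hab hn
      induction hab' with
      | refl => exact .refl
      | tail _ hbc ih =>
        obtain ⟨f, ⟨hf, hfD⟩, hfl⟩ := hbc
        by_cases hfe : f = e
        · subst hfe
          rcases hl.eq_and_eq_or_eq_and_eq hfl with ⟨rfl, rfl⟩ | ⟨rfl, rfl⟩
          exacts [ih.trans hxy, ih.trans hxy.symm]
        · exact ih.tail ⟨f, step f ⟨hf, hfe⟩ hfD, (hlink f ⟨hf, hfe⟩ _ _).2 hfl⟩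
  · refine ⟨insert e D, ?_, ?_, fun hab' => hn ?_⟩
    · rw [Finset.coe_insert]
      exact Set.insert_subset hl.edge_mem (hDE.trans Set.sdiff_subset)
    · rw [Finset.sum_insert heD, Finset.sum_update_of_notMem heD, Function.update_self]
      exact hle.trans hc
    · refine ReflTransGen.mono ?_ _ _ hab'
      rintro u v ⟨f, ⟨hf, hfD⟩, hfl⟩
      rw [Finset.coe_insert] at hfD
      have hfe : f ≠ e := fun h => hfD (.inl h)
      exact ⟨f, step f ⟨hf, hfe⟩ fun h => hfD (.inr h), (hlink f ⟨hf, hfe⟩ _ _).2 hfl⟩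

theorem add_sum_erase_erase_le [DecidableEq β] {f₁ f₂ : β} {c : β → ℕ} {C : Finset β}
    {f : β} (hf : f = f₁ ∨ f = f₂) (hfC : f ∈ C) :
    c f + ∑ f ∈ (C.erase f₁).erase f₂, c f ≤ ∑ f ∈ C, c f := by
  have : f ∉ (C.erase f₁).erase f₂ := by
    rcases hf with rfl | rfl <;> simp
  rw [← Finset.sum_insert this]
  exact Finset.sum_le_sum_of_subset (Finset.insert_subset hfC
    ((Finset.erase_subset _ _).trans (Finset.erase_subset _ _)))

theorem SeriesExt.cutsLE [DecidableEq β] {e f₁ f₂ : β} {x y w : α} {c : β → ℕ} {n : ℕ}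
    (h : SeriesExt G G' e f₁ f₂ x y w) (hc : CutsLE G' c n) :
    CutsLE G (Function.update c e (min (c f₁) (c f₂))) n := by
  refine hc.of_replace h.link (h.vertexSet_eq ▸ Set.subset_insert _ _)
    (edgeSet_eq_insert_insert h.isLink_iff)
    (isLink_iff_of_mem h.notMem₁ h.notMem₂ h.isLink_iff) h.notMem₁ h.notMem₂ fun C => ?_
  by_cases m₁ : f₁ ∈ C
  · exact .inr ((Nat.add_le_add_right (min_le_left _ _) _).trans
      (add_sum_erase_erase_le (.inl rfl) m₁))
  by_cases m₂ : f₂ ∈ C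
  · exact .inr ((Nat.add_le_add_right (min_le_right _ _) _).trans
      (add_sum_erase_erase_le (.inr rfl) m₂))
  · exact .inl (.tail (.single ⟨f₁, ⟨h.link₁.edge_mem, m₁⟩, h.link₁⟩)
      ⟨f₂, ⟨h.link₂.edge_mem, m₂⟩, h.link₂⟩)

theorem ParallelExt.cutsLE [DecidableEq β] {e f₁ f₂ : β} {x y : α} {c : β → ℕ} {n : ℕ}
    (h : ParallelExt G G' e f₁ f₂ x y) (hc : CutsLE G' c n) :
    CutsLE G (Function.update c e (c f₁ + c f₂)) n := by
  refine hc.of_replace h.link h.vertexSet_eq.symm.subset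
    (edgeSet_eq_insert_insert h.isLink_iff)
    (isLink_iff_of_mem h.notMem₁ h.notMem₂ h.isLink_iff) h.notMem₁ h.notMem₂ fun C => ?_
  by_cases m₁ : f₁ ∈ C
  · by_cases m₂ : f₂ ∈ C
    · right
      rw [← Finset.add_sum_erase C c m₁,
        ← Finset.add_sum_erase (C.erase f₁) c (Finset.mem_erase.2 ⟨h.ne.symm, m₂⟩), add_assoc]
    · exact .inl (.single ⟨f₂, ⟨h.link₂.edge_mem, m₂⟩, h.link₂⟩)
  · exact .inl (.single ⟨f₁, ⟨h.link₁.edge_mem, m₁⟩, h.link₁⟩)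

theorem ParallelExt.add_le [DecidableEq β] {e f₁ f₂ : β} {x y : α} {c : β → ℕ} {n : ℕ}
    (h : ParallelExt G G' e f₁ f₂ x y) (hc : CutsLE G' c n) (hxy : x ≠ y) :
    c f₁ + c f₂ ≤ n := by
  obtain ⟨C, -, hle, hn⟩ := hc x h.link₁.left_mem y h.link₁.right_mem hxy
  refine le_trans ?_ hle
  rw [← Finset.sum_pair h.ne]
  refine Finset.sum_le_sum_of_subset fun f hf => ?_
  rcases Finset.mem_insert.1 hf with rfl | hf
  · exact mem_cut h.link₁ hn
  · rw [Finset.mem_singleton.1 hf]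
    exact mem_cut h.link₂ hn

/-- In a series extension, if one of the new edges has the maximal possible capacity, then the
replaced edge is a bridge. -/
theorem SeriesExt.not_conn [DecidableEq β] {e f₁ f₂ : β} {x y w : α} {c : β → ℕ} {n : ℕ}
    (h : SeriesExt G G' e f₁ f₂ x y w) (hc : CutsLE G' c n) (hpos : ∀ f ∈ E(G'), 1 ≤ c f)
    (hn : c f₁ = n) : ¬ Conn G (E(G) \ {e}) x y := by
  have hxw : x ≠ w := fun h' => h.w_notMem (h' ▸ h.link.left_mem)
  obtain ⟨C, hC, hle, hcut⟩ := hc x h.link₁.left_mem w h.link₁.right_mem hxw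
  have m₁ := mem_cut h.link₁ hcut
  -- The edge `f₁` alone exhausts the budget `n`, and all capacities are positive.
  have hC1 : ∀ f ∈ C, f = f₁ := by
    intro f hf
    by_contra hne
    have h2 : c f₁ + c f ≤ ∑ f ∈ C, c f := by
      rw [← Finset.sum_pair (Ne.symm hne)]
      exact Finset.sum_le_sum_of_subset (Finset.insert_subset m₁ (Finset.singleton_subset_iff.2 hf))
    have := hpos f (hC hf)
    omega
  intro hxy
  have hsub : ∀ f ∈ E(G'), f ≠ f₁ → f ∈ E(G') \ C := fun f hf hne => ⟨hf, fun h' => hne (hC1 f h')⟩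
  have hE := edgeSet_eq_insert_insert h.isLink_iff
  -- A walk from `x` to `y` avoiding `e`, continued along `f₂`, would reach `w` without `f₁`.
  refine hcut (ReflTransGen.tail (b := y) ?_
    ⟨f₂, hsub f₂ h.link₂.edge_mem h.ne.symm, h.link₂.symm⟩)
  refine ReflTransGen.mono ?_ _ _ hxy
  rintro a b ⟨f, hf, hl⟩
  exact ⟨f, hsub f (hE ▸ .inr (.inr hf)) fun h' => h.notMem₁ (h' ▸ hf),
    (isLink_iff_of_mem h.notMem₁ h.notMem₂ h.isLink_iff f hf a b).2 hl⟩

theorem FromForest.ne_of_isLink (h : FromForest G) : ∀ {e x y}, G.IsLink e x y → x ≠ y := by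
  induction h with
  | forest h =>
    have := h.1
    intro _ _ _ hl
    exact hl.ne
  | series _ h ih =>
    obtain ⟨e, f₁, f₂, x, y, w, hl, hw, -, -, -, -, hlink⟩ := h
    rintro f a _ hf rfl
    rcases (hlink _ _ _).1 hf with ⟨-, hf⟩ | ⟨-, hf⟩ | ⟨-, hf⟩
    · exact ih hf rfl
    · rcases Sym2.eq_iff.1 hf with ⟨rfl, rfl⟩ | ⟨rfl, rfl⟩ <;> exact hw hl.left_mem
    · rcases Sym2.eq_iff.1 hf with ⟨rfl, rfl⟩ | ⟨rfl, rfl⟩ <;> exact hw hl.right_mem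
  | parallel _ h ih =>
    obtain ⟨e, f₁, f₂, x, y, hl, -, -, -, -, hlink⟩ := h
    rintro f a _ hf rfl
    rcases (hlink _ _ _).1 hf with ⟨-, hf⟩ | ⟨-, hf⟩ | ⟨-, hf⟩
    · exact ih hf rfl
    · rcases Sym2.eq_iff.1 hf with ⟨rfl, rfl⟩ | ⟨rfl, rfl⟩ <;> exact ih hl rfl
    · rcases Sym2.eq_iff.1 hf with ⟨rfl, rfl⟩ | ⟨rfl, rfl⟩ <;> exact ih hl rfl

/-- The weights admitted for an edge of capacity `k ≤ n`. -/
def Admissible (S : ℕ → Set ℂ) (n k : ℕ) (z : ℂ) : Prop :=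
  1 ≤ k ∧ ((k < n ∧ z ∈ S k) ∨
    (k = n ∧ ∃ i j, 1 ≤ i ∧ 1 ≤ j ∧ i + j = n ∧ z ∈ Set.image2 par (S i) (S j)))

theorem Admissible.mem {S : ℕ → Set ℂ} {n k : ℕ} {z : ℂ} (h : Admissible S n k z) (hk : k < n) :
    z ∈ S k := by
  rcases h.2 with h | h
  · exact h.2
  · omega

theorem finite_of_insert_insert {E : Set β} {e f₁ f₂ : β}
    (h : (insert f₁ (insert f₂ (E \ {e}))).Finite) : E.Finite := by
  refine ((h.subset ((Set.subset_insert _ _).trans (Set.subset_insert _ _))).insert e).subset ?_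
  rw [Set.insert_sdiff_singleton]
  exact Set.subset_insert _ _

/-- The reduction of a series-parallel graph to a forest: an edge of capacity `k` stands for a
2-terminal graph with between-terminals flow `k`. -/
theorem FromForest.tutte_ne_zero {q : ℂ} (hq : q ≠ 0) {n : ℕ} {S : ℕ → Set ℂ}
    (h_ser : ∀ k l, 1 ≤ k → k < n → 1 ≤ l → l < n →
      Set.image2 (ser q) (S k) (S l) ⊆ some '' S (min k l))
    (h_par : ∀ k l, 1 ≤ k → 1 ≤ l → k + l < n → Set.image2 par (S k) (S l) ⊆ S (k + l))
    (h_neg : ∀ k z, Admissible S n k z → z ≠ -q)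
    (hG : FromForest G) (hV : V(G).Finite) (hE : E(G).Finite) (c : β → ℕ) (v : β → ℂ)
    (hcv : ∀ e ∈ E(G), Admissible S n (c e) (v e)) (hc : CutsLE G c n) : tutte G q v ≠ 0 := by
  classical
  induction hG generalizing c v with
  | forest h => exact h.tutte_ne_zero hV hE hq fun e he => h_neg _ _ (hcv e he)
  | @series G G' hG h ih =>
    obtain ⟨e, f₁, f₂, x, y, w, hl, hw, hne, hn₁, hn₂, hV', hlink⟩ := h
    have hs : SeriesExt G G' e f₁ f₂ x y w := ⟨hl, hw, hne, hn₁, hn₂, hV', hlink⟩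
    have eE := edgeSet_eq_insert_insert hlink
    have fE : E(G).Finite := finite_of_insert_insert (eE ▸ hE)
    have fV : V(G).Finite := (hV' ▸ hV).subset (Set.subset_insert _ _)
    have a₁ := hcv f₁ hs.link₁.edge_mem
    have a₂ := hcv f₂ hs.link₂.edge_mem
    have main : ∀ z, Admissible S n (min (c f₁) (c f₂)) z →
        tutte G q (Function.update v e z) ≠ 0 := by
      intro z hz
      refine ih fV fE _ _ (fun f hf => ?_) (hs.cutsLE hc)
      by_cases hfe : f = e
      · subst hfe
        rwa [Function.update_self, Function.update_self]
      · rw [Function.update_of_ne hfe, Function.update_of_ne hfe]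
        exact hcv f (eE ▸ .inr (.inr ⟨hf, hfe⟩))
    have nonneg : ∀ {f}, f ∈ E(G') → q + v f ≠ 0 := fun hf h0 =>
      h_neg _ _ (hcv _ hf) (by linear_combination h0)
    have le₁ : c f₁ ≤ n := by rcases a₁.2 with h | h <;> omega
    have le₂ : c f₂ ≤ n := by rcases a₂.2 with h | h <;> omega
    -- An edge of capacity `n` is split off as a bridge factor; the merged edge inherits capacity
    -- and weight of the other one.
    rcases le₁.eq_or_lt with e₁ | l₁
    · rw [hs.tutte_eq_mul_of_not_conn fV fE hE q v
        (hs.not_conn hc (fun f hf => (hcv f hf).1) e₁)]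
      refine mul_ne_zero (nonneg hs.link₁.edge_mem) (main _ ?_)
      rwa [e₁, min_eq_right le₂]
    rcases le₂.eq_or_lt with e₂ | l₂
    · rw [hs.symm.tutte_eq_mul_of_not_conn fV fE hE q v
        (hs.symm.not_conn hc (fun f hf => (hcv f hf).1) e₂)]
      refine mul_ne_zero (nonneg hs.link₂.edge_mem) (main _ ?_)
      rwa [e₂, min_eq_left le₁]
    obtain ⟨z, hz, ez⟩ := h_ser _ _ a₁.1 l₁ a₂.1 l₂ ⟨_, a₁.mem l₁, _, a₂.mem l₂, rfl⟩
    unfold ser at ez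
    split_ifs at ez with h0
    rw [hs.tutte_eq_mul fV fE hE q v h0]
    refine mul_ne_zero h0 (main _ ?_)
    rw [← Option.some.inj ez]
    exact ⟨le_min a₁.1 a₂.1, .inl ⟨(min_le_left _ _).trans_lt l₁, hz⟩⟩
  | @parallel G G' hG h ih =>
    obtain ⟨e, f₁, f₂, x, y, hl, hne, hn₁, hn₂, hV', hlink⟩ := h
    have hs : ParallelExt G G' e f₁ f₂ x y := ⟨hl, hne, hn₁, hn₂, hV', hlink⟩
    have eE := edgeSet_eq_insert_insert hlink
    have fE : E(G).Finite := finite_of_insert_insert (eE ▸ hE)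
    have a₁ := hcv f₁ hs.link₁.edge_mem
    have a₂ := hcv f₂ hs.link₂.edge_mem
    -- Since both capacities are positive, each is below `n`, so both weights lie in sets `S k`. The
    -- merged edge may attain `n`, and then its weight is only known to lie in some `S i ∥ S j`.
    have hle := hs.add_le hc (hG.ne_of_isLink hl)
    have p₁ := a₁.1
    have p₂ := a₂.1
    have m₁ := a₁.mem (by omega)
    have m₂ := a₂.mem (by omega)
    rw [hs.tutte_eq fE hE]
    refine ih (hV' ▸ hV) fE _ _ (fun f hf => ?_) (hs.cutsLE hc)
    by_cases hfe : f = e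
    · subst hfe
      rw [Function.update_self, Function.update_self]
      refine ⟨by omega, ?_⟩
      rcases hle.eq_or_lt with he | hlt
      · exact .inr ⟨he, _, _, p₁, p₂, he, _, m₁, _, m₂, rfl⟩
      · exact .inl ⟨hlt, h_par _ _ p₁ p₂ hlt ⟨_, m₁, _, m₂, rfl⟩⟩
    · rw [Function.update_of_ne hfe, Function.update_of_ne hfe]
      exact hcv f (eE ▸ .inr (.inr ⟨hf, hfe⟩))

end capacities

end Potts

/-! ### The theorem. -/

theorem theorem4p1 {α β : Type*} (q : ℂ) (hq : q ≠ 0) (Λ : ℕ) (hΛ : 2 ≤ Λ) (S : ℕ → Set ℂ)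
    (hS : ∀ k l, 1 ≤ k → k ≤ l → l ≤ Λ - 1 → S k ⊆ S l)
    (h_ser : ∀ k l, 1 ≤ k → k ≤ Λ - 1 → 1 ≤ l → l ≤ Λ - 1 →
      Set.image2 (Potts.ser q) (S k) (S l) ⊆ some '' S (min k l))
    (h_par : ∀ k l, 1 ≤ k → 1 ≤ l → k + l ≤ Λ - 1 →
      Set.image2 Potts.par (S k) (S l) ⊆ S (k + l)) :
    (∀ K : Potts.TwoTerminal α β, K.IsSP → ∀ T : Potts.DecompTree K, T.IsMaximal →
      (∀ H ∈ T.nodes, H ≠ K → H.terminalFlow ≤ Λ - 1) →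
      ∀ v : β → ℂ, (∀ e ∈ E(K.graph), v e ∈ S 1) →
      ∀ H ∈ T.nodes, H.terminalFlow ≤ Λ - 1 → H.effWeight q v ∈ some '' S H.terminalFlow) ∧
    (-q ∉ S (Λ - 1) →
      (∀ k l, 1 ≤ k → 1 ≤ l → k + l = Λ → -q ∉ Set.image2 Potts.par (S k) (S l)) →
      ∀ G : Graph α β, V(G).Finite → E(G).Finite → G.Loopless → Potts.IsSeriesParallel G →
        Potts.maxmaxflow G ≤ Λ →
        (∀ v : β → ℂ, (∀ e ∈ E(G), v e ∈ S 1) → Potts.tutte G q v ≠ 0) ∧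
        (-1 ∈ S 1 → ¬ (Potts.chromaticPolynomial G).IsRoot q)) := by
  constructor
  · intro K hK T hT hflow v hv
    exact T.effWeight_mem hq h_ser h_par hT hK.spEdges hflow v hv
  · intro h_neg h_neg' G hV hE hG hSP hmax
    have key : ∀ v : β → ℂ, (∀ e ∈ E(G), v e ∈ S 1) → Potts.tutte G q v ≠ 0 := by
      intro v hv
      have hloop : {e | ∃ x, G.IsLoopAt e x} = ∅ := by simp
      rw [Potts.IsSeriesParallel, hloop, Graph.deleteEdges_empty] at hSP
      refine hSP.tutte_ne_zero hq (n := Λ) (S := S)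
        (fun k l hk hk' hl hl' => h_ser k l hk (by omega) hl (by omega))
        (fun k l hk hl hkl => h_par k l hk hl (by omega)) ?_ hV hE (fun _ => 1) v
        -- Initially every edge has capacity `1`, which is below `Λ` because `2 ≤ Λ`.
        (fun e he => ⟨le_rfl, .inl ⟨by omega, hv e he⟩⟩)
        (Potts.cutsLE_of_maxmaxflow_le hV hE hmax)
      rintro k z ⟨hk, ⟨hkΛ, hz⟩ | ⟨-, i, j, hi, hj, hij, hz⟩⟩ rfl
      -- Monotonicity of `S` reduces all capacities below `Λ` to the single condition on `S (Λ -
      -- 1)`.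
      · exact h_neg (hS k (Λ - 1) hk (by omega) le_rfl hz)
      · exact h_neg' i j hi hj hij hz
    refine ⟨key, fun h1 hroot => ?_⟩
    rw [Polynomial.IsRoot, Potts.eval_chromaticPolynomial hE] at hroot
    exact key _ (fun _ _ => h1) hroot
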